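/- Multigraphs are finite and may have parallel edges and self-loops; a self-loop at $v$ contributes two to the degree of $v$. A path in a multigraph has at least one edge and uses each edge at most once, but may repeat vertices; its length is its number of edges. For a positive integer $\lambda$ and $\delta\in\mathbb{R}_{\ge 0}$, a $(\delta,\lambda)$-path decomposition of a multigraph $G=(V,E)$ is a partition $\mathcal{P}$ of $E$ into edge-disjoint paths of length at most $\lambda$ such that for every $v\in V$ at most $\delta$ paths of $\mathcal{P}$ start or end in $v$, where a closed path from $v$ to $v$ counts twice. In the $\mathsf{LOCAL}$ model, the nodes of an $n$-node multigraph carry distinct natural numbers as identifiers, and each node $v$ has its incident edge-endpoints numbered arbitrarily $0,\dots,d(v)-1$ (its ports). Initially a node knows $n$, its identifier and its degree. In each synchronous round every node sends one message of arbitrary size through each of its ports, receives the messages sent to it and performs an arbitrary local computation. An algorithm computes a path decomposition $\mathcal{P}$ if at the end every node outputs exactly the paths of $\mathcal{P}$ to which it belongs, written in terms of node identifiers and port numbers. Theorem. There is an absolute constant $C$ such that for all integers $\Delta$ and $k$ with $1\le k\le \Delta/2-2$ there is a deterministic $\mathsf{LOCAL}$ algorithm that, for every $n\ge 2$ and on every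 $\Delta$-regular multigraph with $n$ nodes, for all choices of identifiers and port numberings, computes a $(\Delta-2k,\,2^k)$-path decomposition within at most $C\cdot 2^k\log n$ rounds. -/

import Mathlib

open scoped Graph NNReal

namespace LocalModel

/-! ### Finite multigraphs (with parallel edges and self-loops), paths, path decompositions -/

section Multigraph

variable {α β : Type*}

/-- The degree of a vertex of a finite multigraph: a self-loop at `v` contributes two. -/
noncomputable def degree (G : Graph α β) (v : α) : ℕ :=
  (G.incidenceSet v).ncard + (G.loopSet v).ncard

/-- The data of a (candidate) path: the start vertex, and the list of traversed edges, each one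
with the vertex that is reached by traversing it. -/
structure EdgePath (α β : Type*) where
  start : α
  steps : List (β × α)

namespace EdgePath

/-- The edges of a path, in the order of traversal. -/
def edges (p : EdgePath α β) : List β := p.steps.map Prod.fst

/-- The vertices of a path, in the order of traversal. -/
def vertices (p : EdgePath α β) : List α := p.start :: p.steps.map Prod.snd

/-- The last vertex of a path. -/
def finish (p : EdgePath α β) : α := p.vertices.getLast (List.cons_ne_nil _ _)

/-- The number of edges of a path. -/
def length (p : EdgePath α β) : ℕ := p.steps.length

/-- Renaming the vertices and the edges of a path. -/
def map {α' β' : Type*} (f : α → α') (g : β → β') (p : EdgePath α β) : EdgePath α' β' where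
  start := f p.start
  steps := p.steps.map (Prod.map g f)

end EdgePath

/-- Starting in `u`, the list `l` of pairs (edge, next vertex) follows edges of `G`. -/
def IsWalkFrom (G : Graph α β) : α → List (β × α) → Prop
  | u, [] => u ∈ V(G)
  | u, (e, w) :: l => G.IsLink e u w ∧ IsWalkFrom G w l

/-- A path in a multigraph has at least one edge and uses each edge at most once; its vertices
need not be distinct. -/
structure IsPathIn (G : Graph α β) (p : EdgePath α β) : Prop where
  walk : IsWalkFrom G p.start p.steps
  nodup : p.edges.Nodup
  ne_nil : p.steps ≠ []

/-- `P` is a `(δ, l)`-path decomposition of `G`: the members of `P` are paths of `G`, each edge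
of `G` lies on exactly one of them, at most `δ v` of them start or end in `v` (a closed path from
`v` to `v` counts twice, as it is a self-loop of the multigraph whose edges are the paths), and
each of them has length at most `l`. -/
structure IsPathDecomposition (G : Graph α β) (δ : α → ℝ≥0) (l : ℕ)
    (P : Finset (EdgePath α β)) : Prop where
  isPath : ∀ p ∈ P, IsPathIn G p
  partition : ∀ e ∈ E(G), ∃! p, p ∈ P ∧ e ∈ p.edges
  ends_le : ∀ v ∈ V(G),
    (({p | p ∈ P ∧ p.start = v}.ncard + {p | p ∈ P ∧ p.finish = v}.ncard : ℕ) : ℝ≥0) ≤ δ v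
  length_le : ∀ p ∈ P, p.length ≤ l

/-! ### Port numberings -/

/-- The ports (edge-endpoints) of a multigraph: each vertex `v` has ports `0, …, degree v - 1`. -/
abbrev Port (G : Graph α β) : Type _ := Σ v : α, Fin (degree G v)

/-- A port numbering attaches to each port of `v` an edge at `v`, in such a way that each edge is
attached to exactly two ports, one at each of its two ends (so a self-loop at `v` occupies two
ports of `v`). `opp p` is the other port of the edge at `p`. -/
structure PortNumbering (G : Graph α β) where
  edge : Port G → β
  opp : Port G → Port G
  isLink : ∀ p, G.IsLink (edge p) p.1 (opp p).1
  opp_ne : ∀ p, opp p ≠ p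
  edge_eq_iff : ∀ p q, edge p = edge q ↔ q = p ∨ q = opp p
  edge_surj : ∀ e ∈ E(G), ∃ p, edge p = e

namespace PortNumbering

variable {G : Graph α β}

/-- A port is named by the identifier of its vertex and its number at this vertex. -/
def portName (_π : PortNumbering G) (ident : α → ℕ) (p : Port G) : ℕ × ℕ := (ident p.1, p.2)

/-- An edge is named by the unordered pair of the names of its two ports. -/
noncomputable def edgeName (π : PortNumbering G) (ident : α → ℕ) : β → Sym2 (ℕ × ℕ) :=
  Function.extend π.edge (fun p => s(π.portName ident p, π.portName ident (π.opp p)))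
    (fun _ => s((0, 0), (0, 0)))

theorem opp_opp (π : PortNumbering G) (p : Port G) : π.opp (π.opp p) = p := by
  have h : π.edge p = π.edge (π.opp p) := (π.edge_eq_iff _ _).2 (Or.inr rfl)
  rcases (π.edge_eq_iff _ _).1 h.symm with h | h
  · exact absurd h.symm (π.opp_ne p)
  · exact h.symm

theorem edgeName_edge (π : PortNumbering G) (ident : α → ℕ) (p : Port G) :
    π.edgeName ident (π.edge p) = s(π.portName ident p, π.portName ident (π.opp p)) := by
  refine Function.FactorsThrough.extend_apply (f := π.edge) ?_ _ p
  intro a b hab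
  rcases (π.edge_eq_iff _ _).1 hab with rfl | rfl
  · rfl
  · simp only [opp_opp]
    exact Sym2.eq_swap

end PortNumbering

end Multigraph

/-! ### Deterministic algorithms in the LOCAL model -/

/-- A deterministic algorithm in the LOCAL model. A node starts in a state that depends only on
the number `n` of nodes, its own identifier and its own degree. In each round it sends one message
through each of its ports and then updates its state from its old state and the messages that have
arrived through its ports. After `rounds n` rounds it produces its output from its state. Message
sizes and local computations are unrestricted. -/
structure LocalAlgorithm (Out : Type) where
  State : Type
  Msg : Type
  init : (n ident deg : ℕ) → State
  send : State → (port : ℕ) → Msg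
  receive : State → {deg : ℕ} → (Fin deg → Msg) → State
  output : State → Out
  rounds : ℕ → ℕ

namespace LocalAlgorithm

variable {α β : Type*} {Out : Type}

/-- The state of node `v` after `t` synchronous rounds on the network `G` with the given port
numbering and identifiers: the message received at a port is the one that was sent through the
opposite port. -/
noncomputable def stateAt (A : LocalAlgorithm Out) {G : Graph α β} (π : PortNumbering G)
    (ident : α → ℕ) : ℕ → α → A.State
  | 0, v => A.init V(G).ncard (ident v) (degree G v)
  | t + 1, v => A.receive (A.stateAt π ident t v) (fun i : Fin (degree G v) =>
      A.send (A.stateAt π ident t (π.opp ⟨v, i⟩).1) (π.opp ⟨v, i⟩).2)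

/-- The output of node `v` at the end of the execution. -/
noncomputable def outputAt (A : LocalAlgorithm Out) {G : Graph α β} (π : PortNumbering G)
    (ident : α → ℕ) (v : α) : Out :=
  A.output (A.stateAt π ident (A.rounds V(G).ncard) v)

end LocalAlgorithm

/-- What a node outputs when it has to know a set of paths: each path is written down with the
identifiers of its vertices and the names of its edges. -/
abbrev PathSet : Type := Set (EdgePath ℕ (Sym2 (ℕ × ℕ)))

/-- In the execution of `A` on the given network, a `(δ, l)`-path decomposition `P` is computed:
every node outputs exactly the set of those paths of `P` that it belongs to. -/
def ComputesPathDecomposition {α β : Type*} (A : LocalAlgorithm PathSet) {G : Graph α β}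
    (π : PortNumbering G) (ident : α → ℕ) (δ : α → ℝ≥0) (l : ℕ) : Prop :=
  ∃ P : Finset (EdgePath α β), IsPathDecomposition G δ l P ∧
    ∀ v ∈ V(G), A.outputAt π ident v =
      {q | ∃ p ∈ P, v ∈ p.vertices ∧ q = p.map ident (π.edgeName ident)}

end LocalModel

namespace LocalModel

/-! ### Networks of identifiers -/

/-! Start with every edge as a path of its own and repeat `k` times: each node picks two of the path
ends at it and joins the two paths there. If no path is picked at both of its ends, each new path
consists of at most two old ones, so the length bound doubles, while every node loses exactly two
path ends (`IsPathSystem.merge`). After `k` repetitions the lengths are at most `2 ^ k` and `Δ - 2 *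
k` ends remain at each node.

The picking is a sinkless orientation problem. As long as at least six path ends remain at a node,
they split into two cells of at least three ends each. Regard the paths as edges of a multigraph on
the `2 * n` cells: each cell must pick one of its edges, and no edge may be picked from both sides.
Minimum degree three makes balls grow until, at logarithmic radius, some ball contains at least as
many edges as cells, hence a cycle; directing the cells of that ball towards a non-tree edge gives
each of them an outgoing edge of its own (`exists_trap`). To make these local solutions compatible,
enumerate all finite sets of ports and let each cell use the first such trap that meets it. If an
edge were picked from both sides, each of the two traps would also meet the other cell, so by
minimality they would coincide, but a trap never contains both ends of a path (`far_choice_ne`).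

Merging paths of length `2 ^ i` requires a view of radius of order `2 ^ i * log n`, and these radii
sum geometrically (`exists_isPathSystem`). The algorithm collects a neighbourhood of the resulting
radius and evaluates the construction on any network consistent with it. Taking identifiers as nodes
lets different networks be compared directly (`Net.Agree`); port names translate the result back to
the multigraph. -/

/-- A `Δ`-regular port-numbered network whose nodes are their own identifiers. A dart `(v, i)` is
the port `i` of the node `v`, and `opp` is the involution that exchanges the two ports of an
edge. -/
structure Net (Δ : ℕ) where
  nodes : Finset ℕ
  opp : ℕ × ℕ → ℕ × ℕ
  opp_mem : ∀ d ∈ nodes ×ˢ Finset.range Δ, opp d ∈ nodes ×ˢ Finset.range Δ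
  opp_opp : ∀ d ∈ nodes ×ˢ Finset.range Δ, opp (opp d) = d
  opp_ne : ∀ d ∈ nodes ×ˢ Finset.range Δ, opp d ≠ d

namespace Net

variable {Δ : ℕ} (N N₁ N₂ : Net Δ)

/-- The ports of a network. -/
def darts : Finset (ℕ × ℕ) := N.nodes ×ˢ Finset.range Δ

variable {N N₁ N₂}

theorem mem_darts {d : ℕ × ℕ} : d ∈ N.darts ↔ d.1 ∈ N.nodes ∧ d.2 < Δ := by
  simp [darts]

variable (N)

/-- The nodes at distance at most `t` from `v`. -/
def ball : ℕ → ℕ → Set ℕ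
  | 0, v => {v}
  | t + 1, v => {u | u ∈ ball t v ∨ ∃ i < Δ, u ∈ ball t (N.opp (v, i)).1}

variable {N}

theorem self_mem_ball (t v : ℕ) : v ∈ N.ball t v := by
  induction t with
  | zero => exact rfl
  | succ t ih => exact Or.inl ih

theorem ball_mono {s t : ℕ} (h : s ≤ t) (v : ℕ) : N.ball s v ⊆ N.ball t v := by
  induction h with
  | refl => exact subset_rfl
  | step _ ih => exact fun u hu => Or.inl (ih hu)

theorem mem_ball_trans {s t u v x : ℕ} (hu : u ∈ N.ball s v) (hx : x ∈ N.ball t u) :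
    x ∈ N.ball (s + t) v := by
  induction s generalizing v with
  | zero =>
    obtain rfl : u = v := hu
    simpa using hx
  | succ s ih =>
    rw [Nat.add_right_comm]
    rcases hu with hu | ⟨i, hi, hu⟩
    · exact Or.inl (ih hu)
    · exact Or.inr ⟨i, hi, ih hu⟩

theorem opp_mem_ball {v i : ℕ} (hi : i < Δ) : (N.opp (v, i)).1 ∈ N.ball 1 v :=
  Or.inr ⟨i, hi, rfl⟩

theorem mem_nodes_of_mem_ball {t u v : ℕ} (hv : v ∈ N.nodes) (hu : u ∈ N.ball t v) :
    u ∈ N.nodes := by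
  induction t generalizing v with
  | zero =>
    obtain rfl : u = v := hu
    exact hv
  | succ t ih =>
    rcases hu with hu | ⟨i, hi, hu⟩
    · exact ih hv hu
    · exact ih (mem_darts.1 (N.opp_mem (v, i) (mem_darts.2 ⟨hv, hi⟩))).1 hu

theorem mem_ball_symm {t u v : ℕ} (hv : v ∈ N.nodes) (hu : u ∈ N.ball t v) :
    v ∈ N.ball t u := by
  induction t generalizing v with
  | zero =>
    obtain rfl : u = v := hu
    exact rfl
  | succ t ih =>
    rcases hu with hu | ⟨i, hi, hu⟩
    · exact Or.inl (ih hv hu)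
    · have hd : (v, i) ∈ N.darts := mem_darts.2 ⟨hv, hi⟩
      have hd' := mem_darts.1 (N.opp_mem _ hd)
      have := ih hd'.1 hu
      refine mem_ball_trans this ?_
      have h2 := opp_mem_ball (N := N) (v := (N.opp (v, i)).1) hd'.2
      rwa [Prod.mk.eta, N.opp_opp _ hd] at h2

/-! ### Networks that look alike around a node -/

/-- A ball is explored by following ports of its own nodes, so agreement on the ball of one network
forces both balls to coincide. This makes `Agree` symmetric although it mentions only the ball of
`N₁`. -/
theorem ball_eq_of_opp_eq {t v : ℕ}
    (h : ∀ u ∈ N₁.ball t v, ∀ i < Δ, N₁.opp (u, i) = N₂.opp (u, i)) :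
    N₁.ball t v = N₂.ball t v := by
  induction t generalizing v with
  | zero => rfl
  | succ t ih =>
    ext u
    refine or_congr (by rw [ih fun u hu => h u (Or.inl hu)])
      (exists_congr fun i => and_congr_right fun hi => ?_)
    rw [ih fun u hu => h u (Or.inr ⟨i, hi, hu⟩), h v (self_mem_ball _ _) i hi]

/-- The networks `N₁` and `N₂` have the node `v` and the same edges around the nodes at distance
at most `t` from `v`. -/
structure Agree (N₁ N₂ : Net Δ) (t v : ℕ) : Prop where
  left : v ∈ N₁.nodes
  right : v ∈ N₂.nodes
  opp_eq : ∀ u ∈ N₁.ball t v, ∀ i < Δ, N₁.opp (u, i) = N₂.opp (u, i)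

theorem Agree.mono {s t v : ℕ} (h : Agree N₁ N₂ t v) (hst : s ≤ t) : Agree N₁ N₂ s v :=
  ⟨h.left, h.right, fun u hu => h.opp_eq u (ball_mono hst v hu)⟩

theorem Agree.ball_eq {t v : ℕ} (h : Agree N₁ N₂ t v) : N₁.ball t v = N₂.ball t v :=
  ball_eq_of_opp_eq h.opp_eq

theorem Agree.of_mem_ball {s t u v : ℕ} (h : Agree N₁ N₂ (s + t) v) (hu : u ∈ N₁.ball s v) :
    Agree N₁ N₂ t u :=
  ⟨mem_nodes_of_mem_ball h.left hu,
    mem_nodes_of_mem_ball h.right ((h.mono (Nat.le_add_right s t)).ball_eq ▸ hu),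
    fun _ hx => h.opp_eq _ (mem_ball_trans hu hx)⟩

theorem Agree.symm {t v : ℕ} (h : Agree N₁ N₂ t v) : Agree N₂ N₁ t v :=
  ⟨h.right, h.left, fun u hu i hi => (h.opp_eq u (h.ball_eq ▸ hu) i hi).symm⟩

/-! ### What a node learns in `t` rounds -/

variable (N)

/-- The pairs of opposite ports that a node knows after `t` rounds of collecting information. -/
def know : ℕ → ℕ → Set ((ℕ × ℕ) × (ℕ × ℕ))
  | 0, _ => ∅
  | t + 1, v => {x | x ∈ know t v ∨
      ∃ i < Δ, x = ((v, i), N.opp (v, i)) ∨ x ∈ know t (N.opp (v, i)).1}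

variable {N}

theorem eq_opp_of_mem_know {t v : ℕ} {x : (ℕ × ℕ) × (ℕ × ℕ)} (h : x ∈ N.know t v) :
    x.2 = N.opp x.1 := by
  induction t generalizing v with
  | zero => exact h.elim
  | succ t ih =>
    rcases h with h | ⟨i, -, rfl | h⟩
    · exact ih h
    · rfl
    · exact ih h

theorem mem_know {t u v i : ℕ} (hu : u ∈ N.ball t v) (hi : i < Δ) :
    ((u, i), N.opp (u, i)) ∈ N.know (t + 1) v := by
  induction t generalizing v with
  | zero =>
    obtain rfl : u = v := hu
    exact Or.inr ⟨i, hi, Or.inl rfl⟩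
  | succ t ih =>
    rcases hu with hu | ⟨j, hj, hu⟩
    · exact Or.inl (ih hu)
    · exact Or.inr ⟨j, hj, Or.inr (ih hu)⟩

/-- Seeing what lies behind the ports of nodes at distance `t` costs one more round than reaching
them. -/
theorem agree_of_know_eq {t v : ℕ} (h₁ : v ∈ N₁.nodes) (h₂ : v ∈ N₂.nodes)
    (h : N₁.know (t + 1) v = N₂.know (t + 1) v) : Agree N₁ N₂ t v :=
  ⟨h₁, h₂, fun _ hu _ hi => eq_opp_of_mem_know (h ▸ mem_know hu hi)⟩

end Net

/-! ### Every cell of at least three darts is close to a cycle -/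

/-- The level is the length of a shortest chain to `x`; stepping to lower levels traces a
breadth-first tree rooted at `x`. -/
theorem exists_level_of_reflTransGen {W : Type*} {r : W → W → Prop} {x : W} :
    ∃ lev : W → ℕ, ∀ z, Relation.ReflTransGen r z x → z ≠ x → ∃ z', r z z' ∧
      Relation.ReflTransGen r z' x ∧ lev z' < lev z := by
  classical
  obtain ⟨S, hzero, hsucc⟩ : ∃ S : ℕ → Set W, S 0 = {x} ∧
      ∀ n, S (n + 1) = {z | ∃ z', r z z' ∧ z' ∈ S n} :=
    ⟨fun n => (fun T : Set W => {z | ∃ z', r z z' ∧ z' ∈ T})^[n] {x}, rfl,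
      fun n => Function.iterate_succ_apply' _ _ _⟩
  have hS : ∀ z, Relation.ReflTransGen r z x → ∃ n, z ∈ S n := by
    intro z hz
    induction hz using Relation.ReflTransGen.head_induction_on with
    | refl => exact ⟨0, by rw [hzero]; rfl⟩
    | head h _ ih =>
      obtain ⟨n, hn⟩ := ih
      exact ⟨n + 1, by rw [hsucc]; exact ⟨_, h, hn⟩⟩
  have hS' : ∀ n z, z ∈ S n → Relation.ReflTransGen r z x := by
    intro n
    induction n with
    | zero =>
      intro z hz
      rw [hzero] at hz
      rw [Set.mem_singleton_iff.1 hz]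
    | succ n ih =>
      intro z hz
      rw [hsucc] at hz
      obtain ⟨z', h, hz'⟩ := hz
      exact .head h (ih _ hz')
  refine ⟨fun z => sInf {n | z ∈ S n}, fun z hz hzx => ?_⟩
  have hmem : z ∈ S (sInf {n | z ∈ S n}) := Nat.sInf_mem (s := {n | z ∈ S n}) (hS z hz)
  rcases hm : sInf {n | z ∈ S n} with _ | m
  · rw [hm, hzero] at hmem
    exact absurd hmem hzx
  · rw [hm, hsucc] at hmem
    obtain ⟨z', h, hz'⟩ := hmem
    refine ⟨z', h, hS' _ _ hz', ?_⟩
    simp only [hm]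
    exact Nat.lt_succ_of_le (Nat.sInf_le hz')

section Cells

variable {D W : Type*} (far : D → D) (cell : D → W)

/-- The cells at distance at most `r` from the cell `w`. -/
def cellBall (w : W) : ℕ → Set W
  | 0 => {w}
  | r + 1 => cellBall w r ∪ {z | ∃ d, cell d ∈ cellBall w r ∧ cell (far d) = z}

theorem cellBall_mono (w : W) {s t : ℕ} (h : s ≤ t) :
    cellBall far cell w s ⊆ cellBall far cell w t := by
  induction h with
  | refl => exact subset_rfl
  | step _ ih => exact fun u hu => Or.inl (ih hu)

variable {far cell}

/-- If every cell of the set `B` is joined to `w` inside `B`, and at least as many edges run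
inside `B` as there are cells in `B`, then each cell of `B` can be given an edge of its own. -/
theorem exists_trap_of_dense [Finite D] (hinv : ∀ d, far (far d) = d) (hne : ∀ d, far d ≠ d)
    {B : Finset W} {w : W} (hw : w ∈ B)
    (hconn : ∀ z ∈ B, Relation.ReflTransGen
      (fun a b => a ∈ B ∧ b ∈ B ∧ ∃ d, cell d = a ∧ cell (far d) = b) z w)
    (hdense : 2 * B.card ≤ {d | cell d ∈ B ∧ cell (far d) ∈ B}.ncard) :
    ∃ Z : Finset D, (∃ d ∈ Z, cell d = w) ∧ (∀ d ∈ Z, far d ∉ Z) ∧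
      (∀ d ∈ Z, ∃ d' ∈ Z, cell d' = cell (far d)) ∧ ∀ d ∈ Z, cell d ∈ B := by
  classical
  have hD : Nonempty D := by
    have h1 : 0 < B.card := Finset.card_pos.2 ⟨w, hw⟩
    obtain ⟨d, -⟩ := Set.nonempty_of_ncard_ne_zero (by omega :
      {d | cell d ∈ B ∧ cell (far d) ∈ B}.ncard ≠ 0)
    exact ⟨d⟩
  obtain ⟨lev, hlev⟩ := exists_level_of_reflTransGen
    (r := fun a b => a ∈ B ∧ b ∈ B ∧ ∃ d, cell d = a ∧ cell (far d) = b) (x := w)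
  have hpar : ∀ z : W, z ∈ B → z ≠ w →
      ∃ d, cell d = z ∧ cell (far d) ∈ B ∧ lev (cell (far d)) < lev z := by
    intro z hz hzw
    obtain ⟨z', ⟨-, hz', d, hd, hd'⟩, -, hl⟩ := hlev z (hconn z hz) hzw
    exact ⟨d, hd, hd' ▸ hz', hd' ▸ hl⟩
  choose! par hpar1 hpar2 hpar3 using hpar
  -- The parent darts of the cells other than `w`, together with their opposites, number at most `2
  -- * (B.card - 1)`, so some dart `e` inside `B` lies off this spanning tree.
  obtain ⟨e, he, heT⟩ : ∃ e ∈ {d | cell d ∈ B ∧ cell (far d) ∈ B},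
      e ∉ (((B.erase w).image par ∪ (B.erase w).image (far ∘ par) : Finset D) : Set D) := by
    refine Set.exists_mem_notMem_of_ncard_lt_ncard (hs := Finset.finite_toSet _) ?_
    rw [Set.ncard_coe_finset]
    have h1 := Finset.card_union_le ((B.erase w).image par) ((B.erase w).image (far ∘ par))
    have h2 := Finset.card_image_le (s := B.erase w) (f := par)
    have h3 := Finset.card_image_le (s := B.erase w) (f := far ∘ par)
    have h4 := Finset.card_erase_add_one hw
    omega
  obtain ⟨he1, he2⟩ := he
  have heT1 : ∀ z ∈ B, z ≠ w → par z ≠ e := fun z hz hzw h => heT (by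
    rw [Finset.coe_union]
    exact Or.inl (Finset.mem_coe.2 (Finset.mem_image.2 ⟨z, Finset.mem_erase.2 ⟨hzw, hz⟩, h⟩)))
  have heT2 : ∀ z ∈ B, z ≠ w → par z ≠ far e := fun z hz hzw h => heT (by
    rw [Finset.coe_union]
    exact Or.inr (Finset.mem_coe.2 (Finset.mem_image.2
      ⟨z, Finset.mem_erase.2 ⟨hzw, hz⟩, by simp [h, hinv]⟩)))
  -- Adjacency in `B` after deleting the edge of `e`. The tree still connects `B`, so a second tree,
  -- rooted at `cell e`, avoids that edge.
  let r : W → W → Prop := fun a b =>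
    a ∈ B ∧ b ∈ B ∧ ∃ d, cell d = a ∧ cell (far d) = b ∧ d ≠ e ∧ d ≠ far e
  have hr : Std.Symm r := by
    constructor
    rintro a b ⟨ha, hb, d, h1, h2, h3, h4⟩
    exact ⟨hb, ha, far d, h2, by rw [hinv, h1], fun h => h4 (by rw [← h, hinv]),
      fun h => h3 (by rw [← hinv d, h, hinv])⟩
  have hrw : ∀ m z, z ∈ B → lev z = m → Relation.ReflTransGen r z w := by
    intro m
    induction m using Nat.strong_induction_on with
    | _ m ih =>
      intro z hz hm
      by_cases hzw : z = w
      · rw [hzw]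
      · refine .head (b := cell (far (par z))) ⟨hz, hpar2 z hz hzw, par z, hpar1 z hz hzw, rfl,
          heT1 z hz hzw, heT2 z hz hzw⟩ ?_
        exact ih _ (hm ▸ hpar3 z hz hzw) _ (hpar2 z hz hzw) rfl
  have hre : ∀ z ∈ B, Relation.ReflTransGen r z (cell e) := fun z hz =>
    (hrw _ z hz rfl).trans (Relation.ReflTransGen.stdSymm.symm _ _ (hrw _ _ he1 rfl))
  obtain ⟨lev', hlev'⟩ := exists_level_of_reflTransGen (r := r) (x := cell e)
  have hpar' : ∀ z : W, z ∈ B → z ≠ cell e →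
      ∃ d, cell d = z ∧ cell (far d) ∈ B ∧ lev' (cell (far d)) < lev' z ∧ d ≠ e ∧ d ≠ far e := by
    intro z hz hzw
    obtain ⟨z', ⟨-, hz', d, hd, hd', h3, h4⟩, -, hl⟩ := hlev' z (hre z hz) hzw
    exact ⟨d, hd, hd' ▸ hz', hd' ▸ hl, h3, h4⟩
  choose! p hp1 hp2 hp3 hp4 hp5 using hpar'
  have hZ : ∀ d, d ∈ insert e ((B.erase (cell e)).image p) ↔
      d = e ∨ ∃ z ∈ B, z ≠ cell e ∧ p z = d := by
    intro d
    simp only [Finset.mem_insert, Finset.mem_image, Finset.mem_erase]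
    exact or_congr_right (exists_congr fun z => by tauto)
  have htouch : ∀ z ∈ B, ∃ d ∈ insert e ((B.erase (cell e)).image p), cell d = z := by
    intro z hz
    by_cases h : z = cell e
    · exact ⟨e, (hZ _).2 (Or.inl rfl), h.symm⟩
    · exact ⟨p z, (hZ _).2 (Or.inr ⟨z, hz, h, rfl⟩), hp1 z hz h⟩
  -- Each cell of `B` gets one outgoing dart: `e` at the new root, the parent dart elsewhere. Two
  -- opposite parent darts would decrease `lev'` in both directions.
  refine ⟨insert e ((B.erase (cell e)).image p), htouch w hw, ?_, ?_, ?_⟩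
  · intro d hd hfd
    rcases (hZ _).1 hd with rfl | ⟨z, hz, hze, rfl⟩
    · rcases (hZ _).1 hfd with h | ⟨z, hz, hze, h⟩
      · exact hne _ h
      · exact hp5 z hz hze h
    · rcases (hZ _).1 hfd with h | ⟨y, hy, hye, h⟩
      · exact hp5 z hz hze (by rw [← h, hinv])
      · have h1 := hp3 z hz hze
        have h2 := hp3 y hy hye
        rw [h, hinv, hp1 z hz hze] at h2
        rw [← h, hp1 y hy hye] at h1
        omega
  · intro d hd
    rcases (hZ _).1 hd with rfl | ⟨z, hz, hze, rfl⟩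
    · exact htouch _ he2
    · exact htouch _ (hp2 z hz hze)
  · intro d hd
    rcases (hZ _).1 hd with rfl | ⟨z, hz, hze, rfl⟩
    · exact he1
    · rwa [hp1 z hz hze]

/-- If each cell has at least three darts, then at logarithmic distance from each cell there is a
set of darts that contains no dart together with its opposite, and that leaves every cell into
which it leads. -/
theorem exists_trap [Finite D] (hinv : ∀ d, far (far d) = d) (hne : ∀ d, far d ≠ d)
    {C : Finset W} (hC : ∀ d, cell d ∈ C) (h3 : ∀ z ∈ C, 3 ≤ {d | cell d = z}.ncard)
    {w : W} (hw : w ∈ C) {l : ℕ} (hl : 2 ^ l * C.card < 3 ^ l) :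
    ∃ Z : Finset D, (∃ d ∈ Z, cell d = w) ∧ (∀ d ∈ Z, far d ∉ Z) ∧
      (∀ d ∈ Z, ∃ d' ∈ Z, cell d' = cell (far d)) ∧ ∀ d ∈ Z, cell d ∈ cellBall far cell w l := by
  classical
  have hsub : ∀ r, cellBall far cell w r ⊆ C := by
    intro r
    induction r with
    | zero =>
      rintro z rfl
      exact hw
    | succ r ih =>
      rintro z (hz | ⟨d, -, rfl⟩)
      · exact ih hz
      · exact hC _
  have hfin : ∀ r, (cellBall far cell w r).Finite := fun r => C.finite_toSet.subset (hsub r)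
  let B : ℕ → Finset W := fun r => (hfin r).toFinset
  have hB : ∀ r z, z ∈ B r ↔ z ∈ cellBall far cell w r := fun r z => (hfin r).mem_toFinset
  have hself : ∀ r, w ∈ B r := fun r => (hB r w).2 (cellBall_mono far cell w r.zero_le rfl)
  -- Otherwise each of the first `l` balls would grow by a factor above `3 / 2`, and the last one
  -- would have more cells than `C`.
  obtain ⟨r, hrl, hr⟩ : ∃ r < l, 2 * (B (r + 1)).card ≤ 3 * (B r).card := by
    by_contra! hcon
    have : ∀ r ≤ l, 3 ^ r ≤ 2 ^ r * (B r).card := by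
      intro r
      induction r with
      | zero => exact fun _ => by simpa using (Finset.card_pos.2 ⟨w, hself 0⟩)
      | succ r ih =>
        intro h
        have h1 := ih (by omega)
        have h2 := hcon r (by omega)
        calc 3 ^ (r + 1) = 3 * 3 ^ r := by ring
          _ ≤ 3 * (2 ^ r * (B r).card) := by gcongr
          _ = 2 ^ r * (3 * (B r).card) := by ring
          _ ≤ 2 ^ r * (2 * (B (r + 1)).card) := by gcongr
          _ = _ := by ring
    have h1 := this l le_rfl
    have h2 : (B l).card ≤ C.card :=
      Finset.card_le_card fun z hz => hsub l ((hB l z).1 hz)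
    have h3 := Nat.mul_le_mul_left (2 ^ l) h2
    omega
  have hcount : 3 * (B r).card ≤ {d | cell d ∈ B r}.ncard := by
    have hfinD : {d | cell d ∈ B r}.Finite := Set.toFinite _
    rw [Set.ncard_eq_toFinset_card _ hfinD]
    refine Finset.mul_card_image_le_card_of_maps_to (f := cell)
      (fun d hd => hfinD.mem_toFinset.1 hd) 3 fun z hz => ?_
    have hz' : z ∈ C := hsub r ((hB r z).1 hz)
    refine (h3 z hz').trans ?_
    rw [← Set.ncard_coe_finset]
    refine Set.ncard_le_ncard ?_ (Finset.finite_toSet _)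
    rintro d rfl
    simpa using hz
  have hconn : ∀ z ∈ B (r + 1), Relation.ReflTransGen (fun a b =>
      a ∈ B (r + 1) ∧ b ∈ B (r + 1) ∧ ∃ d, cell d = a ∧ cell (far d) = b) z w := by
    suffices h : ∀ s ≤ r + 1, ∀ z ∈ B s, Relation.ReflTransGen (fun a b =>
        a ∈ B (r + 1) ∧ b ∈ B (r + 1) ∧ ∃ d, cell d = a ∧ cell (far d) = b) z w from
      h (r + 1) le_rfl
    have hmono : ∀ s ≤ r + 1, ∀ z ∈ B s, z ∈ B (r + 1) := fun s hs z hz =>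
      (hB _ _).2 (cellBall_mono far cell w hs ((hB _ _).1 hz))
    intro s
    induction s with
    | zero =>
      intro _ z hz
      obtain rfl : z = w := (hB 0 z).1 hz
      exact .refl
    | succ s ih =>
      intro hs z hz
      rcases (hB _ z).1 hz with h | ⟨d, hd, rfl⟩
      · exact ih (by omega) z ((hB _ z).2 h)
      · have hd' := (hB _ _).2 hd
        exact .head ⟨hmono _ hs _ hz, hmono s (by omega) _ hd', far d, rfl, by rw [hinv]⟩
          (ih (by omega) _ hd')
  have hdense : 2 * (B (r + 1)).card ≤
      {d | cell d ∈ B (r + 1) ∧ cell (far d) ∈ B (r + 1)}.ncard := by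
    -- At least `3 * (B r).card` darts start in `B r`, and all of them lead into `B (r + 1)`.
    refine hr.trans (hcount.trans (Set.ncard_le_ncard ?_ (Set.toFinite _)))
    intro d hd
    have hd' := (hB _ _).1 hd
    exact ⟨(hB _ _).2 (Or.inl hd'), (hB _ _).2 (Or.inr ⟨d, hd', rfl⟩)⟩
  obtain ⟨Z, hZ1, hZ2, hZ3, hZ4⟩ := exists_trap_of_dense hinv hne (hself (r + 1)) hconn hdense
  exact ⟨Z, hZ1, hZ2, hZ3, fun d hd =>
    cellBall_mono far cell w (by omega) ((hB (r + 1) _).1 (hZ4 d hd))⟩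

end Cells

namespace Net

variable {Δ : ℕ}

/-! ### Systems of edge-disjoint paths -/

/-- If the path that leaves through the port `p` consists of the ports `F p`, then `far F p` is
the port at its other end. -/
def far (N : Net Δ) (F : ℕ × ℕ → List (ℕ × ℕ)) (p : ℕ × ℕ) : ℕ × ℕ := N.opp ((F p).getLastD p)

/-- The edges are partitioned into paths of length at most `2 ^ i` such that `Δ - 2 * i` paths
start or end in each node. A path is written down, once from each of its two ends, as the list of
the ports through which it leaves its nodes; `F p` is the path whose first port is `p`, and is
empty if there is none. -/
structure IsPathSystem (N : Net Δ) (i : ℕ) (F : ℕ × ℕ → List (ℕ × ℕ)) : Prop where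
  head?_eq : ∀ p, F p ≠ [] → (F p).head? = some p
  chain : ∀ p, (F p).IsChain fun a b => (N.opp a).1 = b.1
  reverse : ∀ p, F p ≠ [] → F (N.far F p) = ((F p).map N.opp).reverse
  far_ne : ∀ p, F p ≠ [] → N.far F p ≠ p
  mem_darts : ∀ p, ∀ d ∈ F p, d ∈ N.darts
  cover : ∀ d ∈ N.darts, ∃! p, d ∈ F p
  nodup : ∀ p, (F p).Nodup
  length_le : ∀ p, (F p).length ≤ 2 ^ i
  count : ∀ v ∈ N.nodes, {j | F (v, j) ≠ []}.ncard + 2 * i = Δ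

variable {N : Net Δ} {i : ℕ} {F : ℕ × ℕ → List (ℕ × ℕ)}

theorem exists_far_eq_opp {p : ℕ × ℕ} (hp : F p ≠ []) :
    ∃ x ∈ F p, (F p).getLast? = some x ∧ N.far F p = N.opp x :=
  ⟨(F p).getLast hp, List.getLast_mem hp, List.getLast?_eq_some_getLast hp, by
    rw [far, List.getLastD_eq_getLast?, List.getLast?_eq_some_getLast hp, Option.getD_some]⟩

theorem far_eq_opp_of_getLast?_eq {p x : ℕ × ℕ} (h : (F p).getLast? = some x) :
    N.far F p = N.opp x := by
  rw [far, List.getLastD_eq_getLast?, h, Option.getD_some]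

theorem mem_ball_of_isChain {a : ℕ × ℕ} {l : List (ℕ × ℕ)}
    (hl : l.IsChain fun a b => (N.opp a).1 = b.1) (hd : ∀ d ∈ l, d ∈ N.darts)
    (ha : l.head? = some a) {x : ℕ × ℕ} (hx : x ∈ l) :
    x.1 ∈ N.ball l.length a.1 ∧ (N.opp x).1 ∈ N.ball l.length a.1 := by
  induction l generalizing a with
  | nil => cases hx
  | cons b t ih =>
    obtain rfl : b = a := by simpa using ha
    have hb : (N.opp b).1 ∈ N.ball 1 b.1 :=
      opp_mem_ball (v := b.1) (mem_darts.1 (hd b (by simp))).2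
    rcases List.mem_cons.1 hx with rfl | hx
    · exact ⟨self_mem_ball _ _, ball_mono (by simp) _ hb⟩
    · obtain ⟨c, hc⟩ : ∃ c, t.head? = some c :=
        Option.isSome_iff_exists.1 (List.isSome_head?.2 (List.ne_nil_of_mem hx))
      have h1 := ih (List.isChain_cons.1 hl).2 (fun d hd' => hd d (by simp [hd'])) hc hx
      have h2 : (N.opp b).1 = c.1 := (List.isChain_cons.1 hl).1 c hc
      rw [← h2] at h1
      rw [List.length_cons, Nat.add_comm]
      exact ⟨mem_ball_trans hb h1.1, mem_ball_trans hb h1.2⟩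

namespace IsPathSystem

variable (h : N.IsPathSystem i F)
include h

theorem self_mem {p : ℕ × ℕ} (hp : F p ≠ []) : p ∈ F p :=
  List.mem_of_mem_head? (h.head?_eq p hp)

theorem self_mem_darts {p : ℕ × ℕ} (hp : F p ≠ []) : p ∈ N.darts :=
  h.mem_darts p p (h.self_mem hp)

theorem finite_setOf_ne_nil (v : ℕ) : {j | F (v, j) ≠ []}.Finite :=
  (Finset.finite_toSet (Finset.range Δ)).subset fun _ hj => by
    simpa using (Net.mem_darts.1 (h.self_mem_darts hj)).2

theorem map_far_ne_nil {p : ℕ × ℕ} (hp : F p ≠ []) : F (N.far F p) ≠ [] := by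
  rw [h.reverse p hp]
  simpa using hp

theorem far_far {p : ℕ × ℕ} (hp : F p ≠ []) : N.far F (N.far F p) = p := by
  have : (F (N.far F p)).getLast? = some (N.opp p) := by
    rw [h.reverse p hp, List.getLast?_reverse, List.head?_map, h.head?_eq p hp]
    rfl
  rw [far_eq_opp_of_getLast?_eq this]
  exact N.opp_opp p (h.self_mem_darts hp)

theorem eq_of_mem {d p q : ℕ × ℕ} (hp : d ∈ F p) (hq : d ∈ F q) : p = q :=
  (h.cover d (h.mem_darts p d hp)).unique hp hq

theorem mem_ball {p x : ℕ × ℕ} (hx : x ∈ F p) :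
    x.1 ∈ N.ball (2 ^ i) p.1 ∧ (N.opp x).1 ∈ N.ball (2 ^ i) p.1 := by
  have h1 := mem_ball_of_isChain (h.chain p) (h.mem_darts p)
    (h.head?_eq p (List.ne_nil_of_mem hx)) hx
  exact ⟨ball_mono (h.length_le p) _ h1.1, ball_mono (h.length_le p) _ h1.2⟩

theorem far_mem_ball {p : ℕ × ℕ} (hp : F p ≠ []) : (N.far F p).1 ∈ N.ball (2 ^ i) p.1 := by
  obtain ⟨x, hx, -, h2⟩ := exists_far_eq_opp (N := N) hp
  rw [h2]
  exact (h.mem_ball hx).2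

end IsPathSystem

/-! ### Merging two paths at each node -/

open Classical in
/-- The paths that end in a port `q` of the set `S` are continued through the port `m q`. -/
noncomputable def merge (N : Net Δ) (F : ℕ × ℕ → List (ℕ × ℕ)) (S : Set (ℕ × ℕ))
    (m : ℕ × ℕ → ℕ × ℕ) (p : ℕ × ℕ) : List (ℕ × ℕ) :=
  if p ∈ S then [] else if F p ≠ [] ∧ N.far F p ∈ S then F p ++ F (m (N.far F p)) else F p

section Merge

variable {S : Set (ℕ × ℕ)} {m : ℕ × ℕ → ℕ × ℕ}

theorem merge_of_mem {p : ℕ × ℕ} (hp : p ∈ S) : N.merge F S m p = [] := by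
  simp [merge, hp]

theorem merge_of_far_mem {p : ℕ × ℕ} (hp : p ∉ S) (hF : F p ≠ []) (hfar : N.far F p ∈ S) :
    N.merge F S m p = F p ++ F (m (N.far F p)) := by
  simp [merge, hp, hF, hfar]

theorem merge_of_far_notMem {p : ℕ × ℕ} (hp : p ∉ S) (hfar : F p ≠ [] → N.far F p ∉ S) :
    N.merge F S m p = F p := by
  rw [merge, if_neg hp, if_neg fun h => hfar h.1 h.2]

theorem merge_ne_nil_iff {p : ℕ × ℕ} : N.merge F S m p ≠ [] ↔ F p ≠ [] ∧ p ∉ S := by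
  by_cases hp : p ∈ S
  · simp [merge_of_mem hp, hp]
  · by_cases hF : F p = []
    · simp [merge_of_far_notMem hp (fun h => absurd hF h), hF]
    · by_cases hfar : N.far F p ∈ S
      · simp [merge_of_far_mem hp hF hfar, hF, hp]
      · simp [merge_of_far_notMem hp fun _ => hfar, hF, hp]

/-- A path arriving at a picked end `q` continues along the path leaving through `m q`, whose other
end is not picked by `hfar`. So at most two old paths are joined, and the two picked ends at each
node become interior. -/
theorem IsPathSystem.merge (h : N.IsPathSystem i F) (hS : ∀ c ∈ S, F c ≠ [])
    (hfar : ∀ c ∈ S, N.far F c ∉ S) (hm : ∀ c ∈ S, m c ∈ S) (hmm : ∀ c ∈ S, m (m c) = c)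
    (hne : ∀ c ∈ S, m c ≠ c) (hfst : ∀ c ∈ S, (m c).1 = c.1)
    (hcount : ∀ v ∈ N.nodes, {j | (v, j) ∈ S}.ncard = 2) :
    N.IsPathSystem (i + 1) (N.merge F S m) := by
  have hcases : ∀ p, N.merge F S m p ≠ [] → F p ≠ [] ∧ p ∉ S ∧
      ((N.far F p ∉ S ∧ N.merge F S m p = F p ∧ N.far (N.merge F S m) p = N.far F p) ∨
      (N.far F p ∈ S ∧ N.merge F S m p = F p ++ F (m (N.far F p)) ∧
        N.far (N.merge F S m) p = N.far F (m (N.far F p)))) := by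
    intro p hp
    obtain ⟨hF, hpS⟩ := merge_ne_nil_iff.1 hp
    refine ⟨hF, hpS, ?_⟩
    by_cases hfp : N.far F p ∈ S
    · have heq := merge_of_far_mem (m := m) hpS hF hfp
      refine Or.inr ⟨hfp, heq, ?_⟩
      obtain ⟨x, -, h1, h2⟩ := exists_far_eq_opp (N := N) (hS _ (hm _ hfp))
      rw [h2]
      refine far_eq_opp_of_getLast?_eq ?_
      rw [heq, List.getLast?_append, h1]
      rfl
    · have heq := merge_of_far_notMem (N := N) (m := m) hpS fun _ => hfp
      exact Or.inl ⟨hfp, heq, by simp only [far, heq]⟩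
  have hmem : ∀ p d, d ∈ N.merge F S m p → p ∉ S ∧ ((F p ≠ [] ∧ d ∈ F p) ∨
      (F p ≠ [] ∧ N.far F p ∈ S ∧ d ∈ F (m (N.far F p)))) := by
    intro p d hd
    obtain ⟨hF, hpS, ⟨-, heq, -⟩ | ⟨hfp, heq, -⟩⟩ := hcases p (List.ne_nil_of_mem hd)
    · exact ⟨hpS, Or.inl ⟨hF, heq ▸ hd⟩⟩
    · rw [heq, List.mem_append] at hd
      exact ⟨hpS, hd.imp (fun hd => ⟨hF, hd⟩) fun hd => ⟨hF, hfp, hd⟩⟩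
  refine ⟨?_, ?_, ?_, ?_, ?_, ?_, ?_, ?_, ?_⟩
  · intro p hp
    obtain ⟨hF, hpS, ⟨-, heq, -⟩ | ⟨hfp, heq, -⟩⟩ := hcases p hp
    · rw [heq, h.head?_eq p hF]
    · rw [heq, List.head?_append, h.head?_eq p hF]
      rfl
  · intro p
    by_cases hp : N.merge F S m p = []
    · rw [hp]
      exact List.isChain_nil
    obtain ⟨hF, hpS, ⟨-, heq, -⟩ | ⟨hfp, heq, -⟩⟩ := hcases p hp
    · rw [heq]
      exact h.chain p
    · rw [heq, List.isChain_append]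
      refine ⟨h.chain _, h.chain _, ?_⟩
      intro x hx y hy
      rw [h.head?_eq _ (hS _ (hm _ hfp))] at hy
      obtain rfl : m (N.far F p) = y := by simpa using hy
      rw [hfst _ hfp, far_eq_opp_of_getLast?_eq hx]
  · intro p hp
    obtain ⟨hF, hpS, ⟨hfp, heq, hfeq⟩ | ⟨hfp, heq, hfeq⟩⟩ := hcases p hp
    · rw [heq, hfeq, ← h.reverse p hF]
      refine merge_of_far_notMem hfp fun _ => ?_
      rwa [h.far_far hF]
    · have hmS := hm _ hfp
      have hmF := hS _ hmS
      rw [heq, hfeq, List.map_append, List.reverse_append, ← h.reverse p hF, ← h.reverse _ hmF,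
        merge_of_far_mem (hfar _ hmS) (h.map_far_ne_nil hmF) (by rwa [h.far_far hmF]),
        h.far_far hmF, hmm _ hfp]
  · intro p hp
    obtain ⟨hF, hpS, ⟨hfp, heq, hfeq⟩ | ⟨hfp, heq, hfeq⟩⟩ := hcases p hp
    · rw [hfeq]
      exact h.far_ne p hF
    · rw [hfeq]
      intro hc
      have h1 := h.far_far (hS _ (hm _ hfp))
      rw [hc] at h1
      exact hne _ hfp h1.symm
  · intro p d hd
    obtain ⟨-, ⟨-, hd⟩ | ⟨-, -, hd⟩⟩ := hmem p d hd
    · exact h.mem_darts _ d hd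
    · exact h.mem_darts _ d hd
  · intro d hd
    obtain ⟨c, hc, -⟩ := h.cover d hd
    have hcF := List.ne_nil_of_mem hc
    by_cases hcS : c ∈ S
    -- The old path leaving through the picked port `c` is now the second half of the path that
    -- arrives at `m c`, which starts at `N.far F (m c)`.
    · have hmS := hm _ hcS
      have hmF := hS _ hmS
      have hff := h.far_far hmF
      refine ⟨N.far F (m c), ?_, ?_⟩
      · change d ∈ N.merge F S m (N.far F (m c))
        rw [merge_of_far_mem (hfar _ hmS) (h.map_far_ne_nil hmF) (by rwa [hff]), hff, hmm c hcS]
        exact List.mem_append_right _ hc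
      · intro q hq
        obtain ⟨hqS, ⟨-, hq⟩ | ⟨hqF, hfq, hq⟩⟩ := hmem q d hq
        · exact absurd (h.eq_of_mem hc hq ▸ hcS) hqS
        · rw [h.eq_of_mem hc hq, hmm _ hfq, h.far_far hqF]
    · refine ⟨c, ?_, ?_⟩
      · change d ∈ N.merge F S m c
        obtain ⟨-, -, ⟨-, heq, -⟩ | ⟨-, heq, -⟩⟩ := hcases c (merge_ne_nil_iff.2 ⟨hcF, hcS⟩)
        · rwa [heq]
        · rw [heq]
          exact List.mem_append_left _ hc
      · intro q hq
        obtain ⟨hqS, ⟨-, hq⟩ | ⟨hqF, hfq, hq⟩⟩ := hmem q d hq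
        · exact h.eq_of_mem hq hc
        · exact absurd (h.eq_of_mem hq hc ▸ hm _ hfq) hcS
  · intro p
    by_cases hp : N.merge F S m p = []
    · rw [hp]
      exact List.nodup_nil
    obtain ⟨hF, hpS, ⟨-, heq, -⟩ | ⟨hfp, heq, -⟩⟩ := hcases p hp
    · rw [heq]
      exact h.nodup p
    · rw [heq]
      refine (h.nodup _).append (h.nodup _) fun d hd hd' => ?_
      exact hpS (h.eq_of_mem hd' hd ▸ hm _ hfp)
  · intro p
    by_cases hp : N.merge F S m p = []
    · simp [hp]
    have h1 := h.length_le p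
    have h2 := h.length_le (m (N.far F p))
    have h3 := pow_succ 2 i
    obtain ⟨hF, hpS, ⟨-, heq, -⟩ | ⟨hfp, heq, -⟩⟩ := hcases p hp
    · rw [heq]
      omega
    · rw [heq, List.length_append]
      omega
  · intro v hv
    have h1 : {j | N.merge F S m (v, j) ≠ []} = {j | F (v, j) ≠ []} \ {j | (v, j) ∈ S} := by
      ext j
      exact merge_ne_nil_iff
    have h3 := Set.ncard_sdiff_add_ncard_of_subset
      (show {j | (v, j) ∈ S} ⊆ {j | F (v, j) ≠ []} from fun j hj => hS _ hj)
      (h.finite_setOf_ne_nil v)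
    have h4 := h.count v hv
    rw [hcount v hv] at h3
    rw [h1]
    omega

end Merge

end Net

namespace Net

variable {Δ : ℕ}

/-! ### Choosing two ports at each node -/

/-- A subset of three elements. -/
noncomputable def triple (S : Set ℕ) : Set ℕ := Classical.epsilon fun T => T ⊆ S ∧ T.ncard = 3

theorem triple_spec {S : Set ℕ} (hS : 3 ≤ S.ncard) : triple S ⊆ S ∧ (triple S).ncard = 3 :=
  Classical.epsilon_spec (p := fun T => T ⊆ S ∧ T.ncard = 3) (Set.exists_subset_card_eq hS)

/-- The ports of a node in which a path ends are distributed to two cells. -/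
def cell (F : ℕ × ℕ → List (ℕ × ℕ)) (d : ℕ × ℕ) : ℕ × Prop :=
  (d.1, d.2 ∈ triple {j | F (d.1, j) ≠ []})

/-- A set of ends of paths, of diameter at most `R`, that contains at most one of the two ends of
a path and that leaves every cell into which it leads. -/
def IsTrap (N : Net Δ) (F : ℕ × ℕ → List (ℕ × ℕ)) (R : ℕ) (Z : Finset (ℕ × ℕ)) : Prop :=
  ∀ d ∈ Z, F d ≠ [] ∧ N.far F d ∉ Z ∧ (∃ d' ∈ Z, cell F d' = cell F (N.far F d)) ∧
    ∀ d' ∈ Z, d'.1 ∈ N.ball R d.1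

/-- The first trap that meets the cell `w`. -/
noncomputable def firstTrap (N : Net Δ) (F : ℕ × ℕ → List (ℕ × ℕ)) (R : ℕ) (w : ℕ × Prop) :
    Finset (ℕ × ℕ) :=
  Classical.epsilon fun Z => Z ∈ {Z | N.IsTrap F R Z ∧ ∃ d ∈ Z, cell F d = w} ∧
    ∀ Z' ∈ {Z | N.IsTrap F R Z ∧ ∃ d ∈ Z, cell F d = w}, Encodable.encode Z ≤ Encodable.encode Z'

/-- The end of a path that is chosen by the cell `w`. -/
noncomputable def choice (N : Net Δ) (F : ℕ × ℕ → List (ℕ × ℕ)) (R : ℕ) (w : ℕ × Prop) : ℕ × ℕ :=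
  Classical.epsilon fun d => d ∈ N.firstTrap F R w ∧ cell F d = w

variable {N : Net Δ} {i R l : ℕ} {F : ℕ × ℕ → List (ℕ × ℕ)}

theorem firstTrap_spec {w : ℕ × Prop} (hw : ∃ Z, N.IsTrap F R Z ∧ ∃ d ∈ Z, cell F d = w) :
    (N.IsTrap F R (N.firstTrap F R w) ∧ ∃ d ∈ N.firstTrap F R w, cell F d = w) ∧
    ∀ Z, N.IsTrap F R Z → (∃ d ∈ Z, cell F d = w) →
      Encodable.encode (N.firstTrap F R w) ≤ Encodable.encode Z := by
  have h := Classical.epsilon_spec (p := fun Z : Finset (ℕ × ℕ) =>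
    Z ∈ {Z | N.IsTrap F R Z ∧ ∃ d ∈ Z, cell F d = w} ∧
    ∀ Z' ∈ {Z | N.IsTrap F R Z ∧ ∃ d ∈ Z, cell F d = w},
      Encodable.encode Z ≤ Encodable.encode Z') ?_
  · exact ⟨h.1, fun Z h1 h2 => h.2 Z ⟨h1, h2⟩⟩
  · obtain ⟨Z, hZ, hmin⟩ := (measure (Encodable.encode (α := Finset (ℕ × ℕ)))).wf.has_min
      {Z | N.IsTrap F R Z ∧ ∃ d ∈ Z, cell F d = w} hw
    exact ⟨Z, hZ, fun Z' hZ' => not_lt.1 (hmin Z' hZ')⟩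

theorem choice_spec {w : ℕ × Prop} (hw : ∃ Z, N.IsTrap F R Z ∧ ∃ d ∈ Z, cell F d = w) :
    N.choice F R w ∈ N.firstTrap F R w ∧ cell F (N.choice F R w) = w :=
  Classical.epsilon_spec (p := fun d => d ∈ N.firstTrap F R w ∧ cell F d = w)
    (firstTrap_spec hw).1.2

/-- No path is chosen from both of its ends. -/
theorem far_choice_ne (h : N.IsPathSystem i F) {w w' : ℕ × Prop}
    (hw : ∃ Z, N.IsTrap F R Z ∧ ∃ d ∈ Z, cell F d = w)
    (hw' : ∃ Z, N.IsTrap F R Z ∧ ∃ d ∈ Z, cell F d = w') :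
    N.far F (N.choice F R w) ≠ N.choice F R w' := by
  intro heq
  obtain ⟨⟨hZ, -⟩, hmin⟩ := firstTrap_spec hw
  obtain ⟨⟨hZ', -⟩, hmin'⟩ := firstTrap_spec hw'
  obtain ⟨hd, hcell⟩ := choice_spec hw
  obtain ⟨hd', hcell'⟩ := choice_spec hw'
  have hF := (hZ _ hd).1
  obtain ⟨x, hx, hxc⟩ := (hZ _ hd).2.2.1
  obtain ⟨y, hy, hyc⟩ := (hZ' _ hd').2.2.1
  -- The shared path leads from each of the cells `w`, `w'` into the other, so each trap is a
  -- candidate at the other cell. Minimality both ways gives equal codes, hence one trap containing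
  -- both ends of a path.
  have h1 := hmin' _ hZ ⟨x, hx, by rw [hxc, heq, hcell']⟩
  have h2 := hmin _ hZ' ⟨y, hy, by rw [hyc, ← heq, h.far_far hF, hcell]⟩
  have h3 := Encodable.encode_injective (le_antisymm h1 h2)
  exact (hZ _ hd).2.1 (by rw [heq, ← h3]; exact hd')

/-- One step between cells follows a path of at most `2 ^ i` edges. -/
theorem IsPathSystem.mem_ball_of_mem_cellBall (h : N.IsPathSystem i F) {w : ℕ × Prop}
    (far : {d // F d ≠ []} → {d // F d ≠ []}) (hfar : ∀ d, (far d : ℕ × ℕ) = N.far F d) {r : ℕ}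
    {z : ℕ × Prop}
    (hz : z ∈ cellBall far (fun d : {d // F d ≠ []} => cell F d) w r) :
    z.1 ∈ N.ball (2 ^ i * r) w.1 := by
  induction r generalizing z with
  | zero =>
    obtain rfl : z = w := hz
    exact self_mem_ball _ _
  | succ r ih =>
    rcases hz with hz | ⟨d, hd, rfl⟩
    · exact ball_mono (Nat.mul_le_mul_left _ r.le_succ) _ (ih hz)
    · have h1 := ih hd
      have h2 := h.far_mem_ball d.2
      rw [← hfar] at h2
      exact mem_ball_trans h1 h2

/-- Traps of logarithmic diameter meet all cells. -/
theorem IsPathSystem.exists_isTrap (h : N.IsPathSystem i F) (hi : 2 * i + 6 ≤ Δ)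
    (hl : 2 ^ l * (2 * N.nodes.card) < 3 ^ l) {w : ℕ × Prop} (hw : w.1 ∈ N.nodes) :
    ∃ Z, N.IsTrap F (2 ^ i * (2 * l)) Z ∧ ∃ d ∈ Z, cell F d = w := by
  classical
  have hfin : Finite {d // F d ≠ []} :=
    (N.darts.finite_toSet.subset fun d hd => h.self_mem_darts hd : {d | F d ≠ []}.Finite)
  let far : {d // F d ≠ []} → {d // F d ≠ []} := fun d => ⟨N.far F d, h.map_far_ne_nil d.2⟩
  let C : Finset (ℕ × Prop) := N.nodes ×ˢ Finset.univ
  have hCcard : C.card = 2 * N.nodes.card := by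
    simp [C, Finset.card_product, mul_comm]
  have hC : ∀ z, z ∈ C ↔ z.1 ∈ N.nodes := fun z => by simp [C, em]
  have h3 : ∀ z ∈ C, 3 ≤ {d : {d // F d ≠ []} | cell F d = z}.ncard := by
    rintro ⟨v, b⟩ hz
    have hv : v ∈ N.nodes := (hC _).1 hz
    have hcount := h.count v hv
    obtain ⟨ht1, ht2⟩ := triple_spec (S := {j | F (v, j) ≠ []}) (by omega)
    have himage : {j | F (v, j) ≠ [] ∧ (j ∈ triple {j | F (v, j) ≠ []}) = b} ⊆
        (fun d : {d // F d ≠ []} => d.1.2) '' {d : {d // F d ≠ []} | cell F d = (v, b)} := by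
      rintro j ⟨hj, hb⟩
      exact ⟨⟨(v, j), hj⟩, by simp [cell, hb], rfl⟩
    refine le_trans ?_ ((Set.ncard_le_ncard himage (Set.toFinite _)).trans
      (Set.ncard_image_le (Set.toFinite _)))
    by_cases hb : b
    · refine ht2.symm.le.trans (Set.ncard_le_ncard ?_
        ((h.finite_setOf_ne_nil v).subset fun j hj => hj.1))
      exact fun j hj => ⟨ht1 hj, by simp [hj, hb]⟩
    -- By `hi` at least six paths end at `v`, so at least three ends remain outside the triple.
    · have h4 := Set.ncard_sdiff_add_ncard_of_subset ht1 (h.finite_setOf_ne_nil v)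
      have h5 : {j | F (v, j) ≠ []} \ triple {j | F (v, j) ≠ []} ⊆
          {j | F (v, j) ≠ [] ∧ (j ∈ triple {j | F (v, j) ≠ []}) = b} :=
        fun j hj => ⟨hj.1, by simp [hj.2, hb]⟩
      have h6 := Set.ncard_le_ncard h5 ((h.finite_setOf_ne_nil v).subset fun j hj => hj.1)
      omega
  obtain ⟨Z, ⟨d₀, hd₀, hcell⟩, hZ1, hZ2, hZ3⟩ := exists_trap (far := far)
    (cell := fun d : {d // F d ≠ []} => cell F d) (fun d => Subtype.ext (h.far_far d.2))
    (fun d hd => h.far_ne d.1 d.2 (congrArg Subtype.val hd)) (C := C)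
    (fun d => (hC _).2 (Net.mem_darts.1 (h.self_mem_darts d.2)).1) h3 ((hC w).2 hw)
    (by rwa [hCcard])
  refine ⟨Z.map (Function.Embedding.subtype _), ?_, d₀, Finset.mem_map_of_mem _ hd₀, hcell⟩
  intro d hd
  obtain ⟨d, hdZ, rfl⟩ := Finset.mem_map.1 hd
  refine ⟨d.2, ?_, ?_, ?_⟩
  · intro hc
    obtain ⟨d', hd', heq⟩ := Finset.mem_map.1 hc
    exact hZ1 d hdZ ((Subtype.ext heq : d' = far d) ▸ hd')
  · obtain ⟨d', hd', heq⟩ := hZ2 d hdZ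
    exact ⟨d', Finset.mem_map_of_mem _ hd', heq⟩
  · intro d' hd'
    obtain ⟨d', hdZ', rfl⟩ := Finset.mem_map.1 hd'
    have h1 := h.mem_ball_of_mem_cellBall far (fun _ => rfl) (hZ3 d hdZ)
    have h2 := h.mem_ball_of_mem_cellBall far (fun _ => rfl) (hZ3 d' hdZ')
    -- Both ports are within `2 ^ i * l` of `w`; going through `w` gives the diameter `2 ^ i * (2 *
    -- l)`.
    have h4 := mem_ball_trans (mem_ball_symm hw h1) h2
    rw [← two_mul, ← mul_assoc, mul_comm 2, mul_assoc] at h4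
    exact h4

/-! ### The choices depend only on the neighbourhoods of the nodes -/

variable {N₁ N₂ : Net Δ} {F₁ F₂ : ℕ × ℕ → List (ℕ × ℕ)} {r u v : ℕ}

theorem far_congr (h : N₁.IsPathSystem i F₁) (hv : Agree N₁ N₂ (2 ^ i) v) {j : ℕ}
    (heq : F₁ (v, j) = F₂ (v, j)) (hne : F₁ (v, j) ≠ []) :
    N₁.far F₁ (v, j) = N₂.far F₂ (v, j) := by
  obtain ⟨x, hx, h1, h2⟩ := exists_far_eq_opp (N := N₁) hne
  rw [h2, far_eq_opp_of_getLast?_eq (heq ▸ h1)]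
  exact hv.opp_eq _ (h.mem_ball hx).1 _ (mem_darts.1 (h.mem_darts _ _ hx)).2

theorem cell_congr (heq : ∀ j, F₁ (v, j) = F₂ (v, j)) (j : ℕ) :
    cell F₁ (v, j) = cell F₂ (v, j) := by
  simp only [cell, heq]

/-- A trap through `u` lies within `R` of `u`. Checking its diameter from each of its ports needs
another `R`; its paths lead `2 ^ i` beyond it, to nodes where `F` must be known, which takes radius
`r`. -/
theorem isTrap_of_agree (h : N₁.IsPathSystem i F₁)
    (heq : ∀ x, Agree N₁ N₂ r x → ∀ j, F₁ (x, j) = F₂ (x, j))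
    (hu : Agree N₁ N₂ (2 * R + 2 ^ i + r) u) {w : ℕ × Prop} (hw : w.1 = u) {Z : Finset (ℕ × ℕ)}
    (hZ : N₁.IsTrap F₁ R Z ∧ ∃ d ∈ Z, cell F₁ d = w) :
    N₂.IsTrap F₂ R Z ∧ ∃ d ∈ Z, cell F₂ d = w := by
  obtain ⟨hZ, d₀, hd₀, hcell⟩ := hZ
  have hd₀u : d₀.1 = u := by rw [← hw, ← hcell]; rfl
  have hball : ∀ d ∈ Z, d.1 ∈ N₁.ball R u := fun d hd => hd₀u ▸ (hZ _ hd₀).2.2.2 d hd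
  have hagree : ∀ d ∈ Z, Agree N₁ N₂ (R + 2 ^ i + r) d.1 := fun d hd =>
    Agree.of_mem_ball (s := R) (hu.mono (by omega)) (hball d hd)
  have hcong : ∀ d ∈ Z, cell F₁ d = cell F₂ d := fun d hd =>
    cell_congr (heq _ ((hagree d hd).mono (Nat.le_add_left _ _))) d.2
  refine ⟨fun d hd => ?_, d₀, hd₀, by rw [← hcong d₀ hd₀, hcell]⟩
  obtain ⟨h1, h2, ⟨d', hd', h3⟩, h4⟩ := hZ d hd
  have hFd : F₁ d = F₂ d := heq d.1 ((hagree d hd).mono (Nat.le_add_left _ _)) d.2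
  have hfar : N₁.far F₁ d = N₂.far F₂ d :=
    far_congr h (v := d.1)
      ((hagree d hd).mono ((Nat.le_add_left _ _).trans (Nat.le_add_right _ _))) hFd h1
  have hfa : Agree N₁ N₂ r (N₁.far F₁ d).1 :=
    Agree.of_mem_ball (s := 2 ^ i) ((hagree d hd).mono (by gcongr; exact Nat.le_add_left _ _)) (h.far_mem_ball h1)
  refine ⟨hFd ▸ h1, hfar ▸ h2, ⟨d', hd', ?_⟩, ?_⟩
  · rw [← hcong d' hd', h3, ← hfar]
    exact cell_congr (heq _ hfa) _
  · rw [← ((hagree d hd).mono (s := R) ((Nat.le_add_right _ _).trans (Nat.le_add_right _ _))).ball_eq]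
    exact h4

/-- `Classical.epsilon` depends only on its predicate, so networks with the same traps through `w`
make the same choice, even though no explicit rule is given. -/
theorem choice_congr (h₁ : N₁.IsPathSystem i F₁) (h₂ : N₂.IsPathSystem i F₂)
    (heq : ∀ x, Agree N₁ N₂ r x → ∀ j, F₁ (x, j) = F₂ (x, j))
    (hu : Agree N₁ N₂ (2 * R + 2 ^ i + r) u) {w : ℕ × Prop} (hw : w.1 = u) :
    N₁.choice F₁ R w = N₂.choice F₂ R w := by
  have h1 : {Z | N₁.IsTrap F₁ R Z ∧ ∃ d ∈ Z, cell F₁ d = w} =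
      {Z | N₂.IsTrap F₂ R Z ∧ ∃ d ∈ Z, cell F₂ d = w} := by
    ext Z
    exact ⟨isTrap_of_agree h₁ heq hu hw,
      isTrap_of_agree h₂ (fun x hx j => (heq x hx.symm j).symm) hu.symm hw⟩
  have h2 : N₁.firstTrap F₁ R w = N₂.firstTrap F₂ R w := by
    simp only [firstTrap, h1]
  have h3 : ∀ d, cell F₁ d = w ↔ cell F₂ d = w := by
    rintro ⟨x, j⟩
    by_cases hx : x = u
    · subst hx
      rw [cell_congr (heq x (hu.mono (Nat.le_add_left _ _)))]
    · exact ⟨fun hc => absurd ((congrArg Prod.fst hc).trans hw) hx,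
        fun hc => absurd ((congrArg Prod.fst hc).trans hw) hx⟩
  simp only [choice, h2, h3]

end Net

namespace Net

variable {Δ : ℕ}

/-! ### Iterated merging -/

/-- The ports that are chosen at the nodes. -/
def chosen (N : Net Δ) (F : ℕ × ℕ → List (ℕ × ℕ)) (R : ℕ) : Set (ℕ × ℕ) :=
  {c | F c ≠ [] ∧ (c = N.choice F R (c.1, True) ∨ c = N.choice F R (c.1, False))}

open Classical in
/-- The involution that exchanges the two chosen ports of a node. -/
noncomputable def mate (N : Net Δ) (F : ℕ × ℕ → List (ℕ × ℕ)) (R : ℕ) (c : ℕ × ℕ) : ℕ × ℕ :=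
  if c = N.choice F R (c.1, True) then N.choice F R (c.1, False) else N.choice F R (c.1, True)

variable {N : Net Δ} {i R l : ℕ} {F : ℕ × ℕ → List (ℕ × ℕ)}

theorem fst_mate (hcell : ∀ v ∈ N.nodes, ∀ b, cell F (N.choice F R (v, b)) = (v, b)) {c : ℕ × ℕ}
    (hc : c.1 ∈ N.nodes) : (N.mate F R c).1 = c.1 := by
  rw [mate]
  split_ifs
  · exact (congrArg Prod.fst (hcell c.1 hc False) :)
  · exact (congrArg Prod.fst (hcell c.1 hc True) :)

/-- The ports chosen at a node differ because they lie in different cells, and `far_choice_ne`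
prevents a path from being chosen at both ends; these are the requirements for merging. -/
theorem IsPathSystem.merge_chosen (h : N.IsPathSystem i F)
    (htrap : ∀ v ∈ N.nodes, ∀ b, ∃ Z, N.IsTrap F R Z ∧ ∃ d ∈ Z, cell F d = (v, b)) :
    N.IsPathSystem (i + 1) (N.merge F (N.chosen F R) (N.mate F R)) := by
  have hcell : ∀ v ∈ N.nodes, ∀ b, cell F (N.choice F R (v, b)) = (v, b) :=
    fun v hv b => (choice_spec (htrap v hv b)).2
  have hfst : ∀ v ∈ N.nodes, ∀ b, (N.choice F R (v, b)).1 = v :=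
    fun v hv b => congrArg Prod.fst (hcell v hv b)
  have hF : ∀ v ∈ N.nodes, ∀ b, F (N.choice F R (v, b)) ≠ [] := fun v hv b =>
    ((firstTrap_spec (htrap v hv b)).1.1 _ (choice_spec (htrap v hv b)).1).1
  have hne : ∀ v ∈ N.nodes, N.choice F R (v, True) ≠ N.choice F R (v, False) := by
    intro v hv heq
    have h1 := hcell v hv True
    rw [heq, hcell v hv False] at h1
    simpa using congrArg Prod.snd h1
  -- The condition `F c ≠ []` in `chosen` excludes arbitrary values of `choice` at numbers that are
  -- not nodes.
  have hnode : ∀ c ∈ N.chosen F R, c.1 ∈ N.nodes :=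
    fun c hc => (Net.mem_darts.1 (h.self_mem_darts hc.1)).1
  have hmem : ∀ v ∈ N.nodes, ∀ c, c = N.choice F R (v, True) ∨ c = N.choice F R (v, False) →
      c ∈ N.chosen F R := by
    rintro v hv c (rfl | rfl)
    · exact ⟨hF v hv _, Or.inl (by rw [hfst v hv])⟩
    · exact ⟨hF v hv _, Or.inr (by rw [hfst v hv])⟩
  have htrue : ∀ v ∈ N.nodes, N.mate F R (N.choice F R (v, True)) = N.choice F R (v, False) := by
    intro v hv
    rw [mate, hfst v hv, if_pos rfl]
  have hfalse : ∀ v ∈ N.nodes, N.mate F R (N.choice F R (v, False)) = N.choice F R (v, True) := by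
    intro v hv
    rw [mate, hfst v hv, if_neg (hne v hv).symm]
  have hcases : ∀ c ∈ N.chosen F R, ∃ v ∈ N.nodes,
      c = N.choice F R (v, True) ∨ c = N.choice F R (v, False) :=
    fun c hc => ⟨c.1, hnode c hc, hc.2⟩
  refine h.merge (fun c hc => hc.1) ?_ ?_ ?_ ?_ ?_ ?_
  · intro c hc hfc
    have hw := htrap c.1 (hnode c hc)
    have hw' := htrap _ (hnode _ hfc)
    rcases hc.2 with h1 | h1 <;> rcases hfc.2 with h2 | h2 <;>
    · exact far_choice_ne h (hw _) (hw' _) (by rw [← h1, ← h2])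
  · intro c hc
    obtain ⟨v, hv, rfl | rfl⟩ := hcases c hc
    · exact hmem v hv _ (Or.inr (htrue v hv))
    · exact hmem v hv _ (Or.inl (hfalse v hv))
  · intro c hc
    obtain ⟨v, hv, rfl | rfl⟩ := hcases c hc
    · rw [htrue v hv, hfalse v hv]
    · rw [hfalse v hv, htrue v hv]
  · intro c hc
    obtain ⟨v, hv, rfl | rfl⟩ := hcases c hc
    · rw [htrue v hv]
      exact (hne v hv).symm
    · rw [hfalse v hv]
      exact hne v hv
  · exact fun c hc => fst_mate hcell (hnode c hc)
  · intro v hv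
    have h1 : {j | (v, j) ∈ N.chosen F R} =
        {(N.choice F R (v, True)).2, (N.choice F R (v, False)).2} := by
      ext j
      constructor
      · rintro ⟨-, hj | hj⟩
        · exact Or.inl (congrArg Prod.snd hj)
        · exact Or.inr (congrArg Prod.snd hj)
      · rintro (rfl | rfl)
        · exact hmem v hv _ (Or.inl (Prod.ext (hfst v hv _).symm rfl))
        · exact hmem v hv _ (Or.inr (Prod.ext (hfst v hv _).symm rfl))
    rw [h1, Set.ncard_pair]
    exact fun h2 => hne v hv (Prod.ext (by rw [hfst v hv, hfst v hv]) h2)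

/-! ### Locality of a merging step -/

section Congr

variable {N₁ N₂ : Net Δ} {F₁ F₂ : ℕ × ℕ → List (ℕ × ℕ)} {r u v : ℕ}

theorem mem_chosen_congr (h₁ : N₁.IsPathSystem i F₁) (h₂ : N₂.IsPathSystem i F₂)
    (heq : ∀ x, Agree N₁ N₂ r x → ∀ j, F₁ (x, j) = F₂ (x, j))
    (hu : Agree N₁ N₂ (2 * R + 2 ^ i + r) u) (j : ℕ) :
    (u, j) ∈ N₁.chosen F₁ R ↔ (u, j) ∈ N₂.chosen F₂ R := by
  simp only [chosen, Set.mem_ofPred_eq, heq u (hu.mono (Nat.le_add_left _ _)) j,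
    choice_congr h₁ h₂ heq hu (w := (u, True)) rfl, choice_congr h₁ h₂ heq hu (w := (u, False)) rfl]

theorem mate_congr (h₁ : N₁.IsPathSystem i F₁) (h₂ : N₂.IsPathSystem i F₂)
    (heq : ∀ x, Agree N₁ N₂ r x → ∀ j, F₁ (x, j) = F₂ (x, j))
    (hu : Agree N₁ N₂ (2 * R + 2 ^ i + r) u) (j : ℕ) :
    N₁.mate F₁ R (u, j) = N₂.mate F₂ R (u, j) := by
  simp only [mate,
    choice_congr h₁ h₂ heq hu (w := (u, True)) rfl, choice_congr h₁ h₂ heq hu (w := (u, False)) rfl]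

/-- The new path at `v` depends on the choices made at the far end of the old one, up to `2 ^ i`
away; this accounts for the additional `2 ^ i` in the radius. -/
theorem merge_chosen_congr (h₁ : N₁.IsPathSystem i F₁) (h₂ : N₂.IsPathSystem i F₂)
    (htrap : ∀ v ∈ N₁.nodes, ∀ b, ∃ Z, N₁.IsTrap F₁ R Z ∧ ∃ d ∈ Z, cell F₁ d = (v, b))
    (heq : ∀ x, Agree N₁ N₂ r x → ∀ j, F₁ (x, j) = F₂ (x, j))
    (hv : Agree N₁ N₂ (2 ^ i + (2 * R + 2 ^ i + r)) v) (j : ℕ) :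
    N₁.merge F₁ (N₁.chosen F₁ R) (N₁.mate F₁ R) (v, j) =
      N₂.merge F₂ (N₂.chosen F₂ R) (N₂.mate F₂ R) (v, j) := by
  have hFv := heq v (hv.mono ((Nat.le_add_left _ _).trans (Nat.le_add_left _ _))) j
  have hS := mem_chosen_congr h₁ h₂ heq (hv.mono (Nat.le_add_left _ _)) j
  by_cases hj : (v, j) ∈ N₁.chosen F₁ R
  · rw [merge_of_mem hj, merge_of_mem (hS.1 hj)]
  by_cases hF : F₁ (v, j) = []
  · rw [merge_of_far_notMem hj fun hc => absurd hF hc,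
      merge_of_far_notMem (fun hc => hj (hS.2 hc)) fun hc => absurd (hFv ▸ hF) hc, hFv]
  have hfar := far_congr h₁ (hv.mono (Nat.le_add_right _ _)) hFv hF
  have hq := hv.of_mem_ball (h₁.far_mem_ball hF)
  obtain ⟨q, hqdef⟩ : ∃ q, q = N₁.far F₁ (v, j) := ⟨_, rfl⟩
  rw [← hqdef] at hq hfar
  have hqS : q ∈ N₁.chosen F₁ R ↔ q ∈ N₂.chosen F₂ R := mem_chosen_congr h₁ h₂ heq hq q.2
  by_cases hqc : q ∈ N₁.chosen F₁ R
  · rw [merge_of_far_mem hj hF (hqdef ▸ hqc), merge_of_far_mem (fun hc => hj (hS.2 hc)) (hFv ▸ hF)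
      (hfar ▸ hqS.1 hqc), ← hqdef, ← hfar, hFv]
    have hm : N₁.mate F₁ R q = N₂.mate F₂ R q := mate_congr h₁ h₂ heq hq q.2
    rw [← hm]
    have hfst := fst_mate (fun v hv b => (choice_spec (htrap v hv b)).2) hq.left
    have := heq (N₁.mate F₁ R q).1 (by
      rw [hfst]
      exact hq.mono (Nat.le_add_left _ _)) (N₁.mate F₁ R q).2
    exact congrArg _ this
  · rw [merge_of_far_notMem hj fun _ => hqdef ▸ hqc,
      merge_of_far_notMem (fun hc => hj (hS.2 hc)) (fun _ => hfar ▸ fun hc => hqc (hqS.2 hc)), hFv]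

end Congr

open Classical in
theorem isPathSystem_zero (N : Net Δ) :
    N.IsPathSystem 0 fun p => if p ∈ N.darts then [p] else [] := by
  have hne : ∀ p, (if p ∈ N.darts then [p] else []) ≠ [] ↔ p ∈ N.darts := by
    intro p
    split_ifs with h <;> simp [h]
  have hmem : ∀ p d, d ∈ (if p ∈ N.darts then [p] else []) ↔ d = p ∧ p ∈ N.darts := by
    intro p d
    split_ifs with h <;> simp [h]
  have hfar : ∀ p, p ∈ N.darts →
      N.far (fun p => if p ∈ N.darts then [p] else []) p = N.opp p := by
    intro p hp
    simp [far, hp]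
  refine ⟨?_, ?_, ?_, ?_, ?_, ?_, ?_, ?_, ?_⟩
  · intro p hp
    rw [if_pos ((hne p).1 hp)]
    rfl
  · intro p
    split_ifs <;> simp
  · intro p hp
    have hp := (hne p).1 hp
    have hp' : N.opp p ∈ N.darts := N.opp_mem p hp
    rw [hfar p hp]
    simp [hp, hp']
  · intro p hp
    have hp := (hne p).1 hp
    rw [hfar p hp]
    exact N.opp_ne p hp
  · intro p d hd
    obtain ⟨rfl, h⟩ := (hmem p d).1 hd
    exact h
  · intro d hd
    exact ⟨d, (hmem d d).2 ⟨rfl, hd⟩, fun q hq => ((hmem q d).1 hq).1.symm⟩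
  · intro p
    split_ifs <;> simp
  · intro p
    split_ifs <;> simp
  · intro v hv
    have : {j | (if (v, j) ∈ N.darts then [(v, j)] else []) ≠ []} = Set.Iio Δ := by
      ext j
      rw [Set.mem_ofPred_eq, hne, mem_darts]
      simp [hv]
    rw [this, Set.ncard_eq_toFinset_card']
    simp

/-! ### Search radius and induction on the number of mergings -/

/-- Twice a number of steps that suffices to reach a cycle in a network of `n` nodes. -/
def searchDepth (n : ℕ) : ℕ := 2 * (2 * Nat.log 2 n + 4)

/-- With `L = Nat.log 2 n`, the left side is at most `8 ^ (L + 2)` and the right side is `9 ^ (L +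
2)`. The factor `2 * n` is the number of cells. -/
theorem two_pow_mul_lt_three_pow (n : ℕ) :
    2 ^ (2 * Nat.log 2 n + 4) * (2 * n) < 3 ^ (2 * Nat.log 2 n + 4) := by
  have h1 : n < 2 ^ (Nat.log 2 n + 1) := Nat.lt_pow_succ_log_self one_lt_two n
  have h2 : 2 * Nat.log 2 n + 4 = 2 * (Nat.log 2 n + 2) := by ring
  rw [h2, pow_mul, pow_mul]
  calc (2 ^ 2) ^ (Nat.log 2 n + 2) * (2 * n)
      ≤ (2 ^ 2) ^ (Nat.log 2 n + 2) * (2 * 2 ^ (Nat.log 2 n + 1)) := by gcongr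
    _ = 8 ^ (Nat.log 2 n + 2) := by
      rw [← pow_succ', ← mul_pow]
      norm_num
    _ < (3 ^ 2) ^ (Nat.log 2 n + 2) := Nat.pow_lt_pow_left (by norm_num) (by omega)

/-- There are path systems that can be computed locally. -/
theorem exists_isPathSystem {k : ℕ} (hk : 2 * k + 4 ≤ Δ) :
    ∃ F : Net Δ → ℕ × ℕ → List (ℕ × ℕ), (∀ N : Net Δ, N.IsPathSystem k (F N)) ∧
      ∀ N₁ N₂ : Net Δ, N₁.nodes.card = N₂.nodes.card → ∀ v,
        Agree N₁ N₂ (2 ^ k * (2 * searchDepth N₁.nodes.card + 2)) v →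
          ∀ j, F N₁ (v, j) = F N₂ (v, j) := by
  induction k with
  | zero =>
    classical
    refine ⟨fun (N : Net Δ) p => if p ∈ N.darts then [p] else [], isPathSystem_zero, ?_⟩
    intro N₁ N₂ _ v hv j
    simp [mem_darts, hv.left, hv.right]
  | succ k ih =>
    obtain ⟨F, hF, hloc⟩ := ih (by omega)
    have htrap : ∀ N : Net Δ, ∀ v ∈ N.nodes, ∀ b, ∃ Z,
        N.IsTrap (F N) (2 ^ k * searchDepth N.nodes.card) Z ∧ ∃ d ∈ Z, cell (F N) d = (v, b) :=
      fun N v hv b => (hF N).exists_isTrap (by omega) (two_pow_mul_lt_three_pow _) hv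
    refine ⟨fun N => N.merge (F N) (N.chosen (F N) (2 ^ k * searchDepth N.nodes.card))
      (N.mate (F N) (2 ^ k * searchDepth N.nodes.card)), fun N => (hF N).merge_chosen (htrap N), ?_⟩
    intro N₁ N₂ hcard v hv j
    change N₁.merge _ _ _ (v, j) = N₂.merge _ _ _ (v, j)
    rw [← hcard]
    refine merge_chosen_congr (hF N₁) (hF N₂) (htrap N₁) (hloc N₁ N₂ hcard) (hv.mono ?_) j
    -- With `s` the search depth, one merging adds `2 ^ k + 2 * (2 ^ k * s) + 2 ^ k` to the radius
    -- `2 ^ k * (2 * s + 2)`, which exactly doubles it.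
    rw [pow_succ]
    exact le_of_eq (by ring)

end Net

/-! ### The algorithm -/

namespace Net

variable {Δ : ℕ}

/-- A path, given as a list of ports, written down with the names of its nodes and edges. -/
def pathName (N : Net Δ) (v : ℕ) (l : List (ℕ × ℕ)) : EdgePath ℕ (Sym2 (ℕ × ℕ)) where
  start := v
  steps := l.map fun d => (s(d, N.opp d), (N.opp d).1)

/-- The set of the names of the paths that a node belongs to. Of the two directions of a path,
only one is considered. -/
def pathsAt (N : Net Δ) (F : ℕ × ℕ → List (ℕ × ℕ)) (v : ℕ) : PathSet :=
  {q | ∃ p, F p ≠ [] ∧ Encodable.encode p < Encodable.encode (N.far F p) ∧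
    (v = p.1 ∨ ∃ d ∈ F p, v = (N.opp d).1) ∧ q = N.pathName p.1 (F p)}

/-- A path through `v` starts within `2 ^ i` of `v`, and from its start the whole path lies within
another `2 ^ i`. -/
theorem pathsAt_subset {N₁ N₂ : Net Δ} {i r v : ℕ} {F₁ F₂ : ℕ × ℕ → List (ℕ × ℕ)}
    (h : N₁.IsPathSystem i F₁) (heq : ∀ x, Agree N₁ N₂ r x → ∀ j, F₁ (x, j) = F₂ (x, j))
    (hv : Agree N₁ N₂ (2 ^ i + (2 ^ i + r)) v) : N₁.pathsAt F₁ v ⊆ N₂.pathsAt F₂ v := by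
  rintro q ⟨p, hp, hlt, hmem, rfl⟩
  have hvp : v ∈ N₁.ball (2 ^ i) p.1 := by
    rcases hmem with rfl | ⟨d, hd, rfl⟩
    · exact self_mem_ball _ _
    · exact (h.mem_ball hd).2
  have hpa := hv.of_mem_ball (mem_ball_symm (mem_darts.1 (h.self_mem_darts hp)).1 hvp)
  have hF : F₁ p = F₂ p := heq p.1 (hpa.mono (Nat.le_add_left _ _)) p.2
  have hpi : Agree N₁ N₂ (2 ^ i) p.1 := hpa.mono (Nat.le_add_right _ _)
  have hopp : ∀ d ∈ F₁ p, N₁.opp d = N₂.opp d := fun d hd =>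
    hpi.opp_eq _ (h.mem_ball hd).1 _ (mem_darts.1 (h.mem_darts _ _ hd)).2
  have hfar : N₁.far F₁ p = N₂.far F₂ p := far_congr h hpi hF hp
  refine ⟨p, hF ▸ hp, hfar ▸ hlt, hmem.imp_right ?_, ?_⟩
  · rintro ⟨d, hd, rfl⟩
    exact ⟨d, hF ▸ hd, by rw [hopp d hd]⟩
  · simp only [pathName, ← hF]
    congr 1
    exact List.map_congr_left fun d hd => by rw [hopp d hd]

end Net

/-- All nodes collect all information about the network for `T n` rounds; then each node
outputs `out N v`, where `N` is some network of `n` nodes that is consistent with what it has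
seen, and `v` is its identifier. -/
def collectAlgorithm {Δ : ℕ} (T : ℕ → ℕ) (out : Net Δ → ℕ → PathSet) : LocalAlgorithm PathSet where
  State := ℕ × ℕ × Set ((ℕ × ℕ) × (ℕ × ℕ))
  Msg := (ℕ × ℕ) × Set ((ℕ × ℕ) × (ℕ × ℕ))
  init n v _ := (n, v, ∅)
  send s i := ((s.2.1, i), s.2.2)
  receive s _ m := (s.1, s.2.1, {x | x ∈ s.2.2 ∨ ∃ i, x = ((s.2.1, ↑i), (m i).1) ∨ x ∈ (m i).2})
  output s := {q | ∃ N : Net Δ, N.nodes.card = s.1 ∧ s.2.1 ∈ N.nodes ∧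
    N.know (T s.1) s.2.1 = s.2.2 ∧ q ∈ out N s.2.1}
  rounds := T

/-! ### Running the collecting algorithm on a multigraph -/

namespace PortNumbering

variable {α β : Type*} {G : Graph α β} (π : PortNumbering G) {ident : α → ℕ} {Δ : ℕ}

theorem fst_mem (π : PortNumbering G) (p : Port G) : p.1 ∈ V(G) := (π.isLink p).left_mem

theorem portName_injective (hident : Set.InjOn ident V(G)) :
    Function.Injective (π.portName ident) := by
  rintro ⟨v, i⟩ ⟨w, j⟩ h
  obtain rfl : v = w := hident (π.fst_mem ⟨v, i⟩) (π.fst_mem ⟨w, j⟩) (congrArg Prod.fst h)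
  obtain rfl : i = j := Fin.ext (congrArg Prod.snd h)
  rfl

theorem exists_portName_eq (hfin : V(G).Finite) (hdeg : ∀ v ∈ V(G), degree G v = Δ)
    {d : ℕ × ℕ} (hd : d ∈ (hfin.toFinset.image ident) ×ˢ Finset.range Δ) :
    ∃ p, π.portName ident p = d := by
  obtain ⟨h1, h2⟩ := Finset.mem_product.1 hd
  obtain ⟨v, hv, hvd⟩ := Finset.mem_image.1 h1
  have hv' := hdeg v (hfin.mem_toFinset.1 hv)
  exact ⟨⟨v, ⟨d.2, hv'.symm ▸ Finset.mem_range.1 h2⟩⟩, Prod.ext hvd rfl⟩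

theorem portName_mem (hfin : V(G).Finite) (hdeg : ∀ v ∈ V(G), degree G v = Δ) (p : Port G) :
    π.portName ident p ∈ (hfin.toFinset.image ident) ×ˢ Finset.range Δ :=
  Finset.mem_product.2 ⟨Finset.mem_image_of_mem _ (hfin.mem_toFinset.2 (π.fst_mem p)),
    Finset.mem_range.2 (hdeg p.1 (π.fst_mem p) ▸ p.2.2)⟩

/-- The network on the identifiers of the nodes of a regular multigraph. -/
noncomputable def toNet (ident : α → ℕ) (hfin : V(G).Finite)
    (hdeg : ∀ v ∈ V(G), degree G v = Δ) (hident : Set.InjOn ident V(G)) : Net Δ where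
  nodes := hfin.toFinset.image ident
  opp := Function.extend (π.portName ident) (fun p => π.portName ident (π.opp p)) id
  opp_mem d hd := by
    obtain ⟨p, rfl⟩ := π.exists_portName_eq hfin hdeg hd
    rw [(π.portName_injective hident).extend_apply]
    exact π.portName_mem hfin hdeg _
  opp_opp d hd := by
    obtain ⟨p, rfl⟩ := π.exists_portName_eq hfin hdeg hd
    rw [(π.portName_injective hident).extend_apply, (π.portName_injective hident).extend_apply,
      π.opp_opp]
  opp_ne d hd := by
    obtain ⟨p, rfl⟩ := π.exists_portName_eq hfin hdeg hd
    rw [(π.portName_injective hident).extend_apply]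
    exact fun h => π.opp_ne p (π.portName_injective hident h)

variable (hfin : V(G).Finite) (hdeg : ∀ v ∈ V(G), degree G v = Δ) (hident : Set.InjOn ident V(G))

theorem toNet_opp (p : Port G) :
    (π.toNet ident hfin hdeg hident).opp (π.portName ident p) = π.portName ident (π.opp p) :=
  (π.portName_injective hident).extend_apply (fun p => π.portName ident (π.opp p)) id p

theorem mem_toNet_nodes {x : ℕ} :
    x ∈ (π.toNet ident hfin hdeg hident).nodes ↔ ∃ v ∈ V(G), ident v = x := by
  simp [toNet]

theorem card_toNet_nodes : (π.toNet ident hfin hdeg hident).nodes.card = V(G).ncard := by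
  rw [Set.ncard_eq_toFinset_card _ hfin]
  exact Finset.card_image_of_injOn (by simpa using hident)

theorem stateAt_collectAlgorithm (T : ℕ → ℕ) (out : Net Δ → ℕ → PathSet) (t : ℕ) {v : α}
    (hv : v ∈ V(G)) : (collectAlgorithm T out).stateAt π ident t v =
      (V(G).ncard, ident v, (π.toNet ident hfin hdeg hident).know t (ident v)) := by
  induction t generalizing v with
  | zero => rfl
  | succ t ih =>
    simp only [LocalAlgorithm.stateAt, ih hv, ih (π.fst_mem _)]
    simp only [collectAlgorithm]
    refine congrArg _ (congrArg _ (Set.ext fun x => or_congr Iff.rfl ?_))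
    have hopp : ∀ i : Fin (degree G v), (π.toNet ident hfin hdeg hident).opp (ident v, i) =
        (ident (π.opp ⟨v, i⟩).1, ↑(π.opp ⟨v, i⟩).2) := fun i => π.toNet_opp hfin hdeg hident ⟨v, i⟩
    constructor
    · rintro ⟨i, hi⟩
      exact ⟨i, hdeg v hv ▸ i.2, by rwa [hopp]⟩
    · rintro ⟨i, hi, h⟩
      have hi' : i < degree G v := (hdeg v hv).symm ▸ hi
      have h2 : (π.toNet ident hfin hdeg hident).opp (ident v, i) = _ := hopp ⟨i, hi'⟩
      rw [h2] at h
      exact ⟨⟨i, hi'⟩, h⟩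

/-- Every consistent network agrees with the true one around the node, so it contributes only
correct paths, and the true network is itself consistent. Hence a one-sided inclusion in `hout`
suffices. -/
theorem outputAt_collectAlgorithm {T : ℕ → ℕ} {out : Net Δ → ℕ → PathSet}
    (hout : ∀ N₁ N₂ : Net Δ, N₁.nodes.card = N₂.nodes.card → ∀ v,
      Net.Agree N₁ N₂ (T N₁.nodes.card) v → out N₁ v ⊆ out N₂ v) {v : α} (hv : v ∈ V(G)) :
    (collectAlgorithm (fun n => T n + 1) out).outputAt π ident v =
      out (π.toNet ident hfin hdeg hident) (ident v) := by
  have hnode : ident v ∈ (π.toNet ident hfin hdeg hident).nodes :=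
    (π.mem_toNet_nodes hfin hdeg hident).2 ⟨v, hv, rfl⟩
  rw [LocalAlgorithm.outputAt, π.stateAt_collectAlgorithm hfin hdeg hident _ _ _ hv]
  ext q
  constructor
  · rintro ⟨N, hcard, hN, hknow, hq⟩
    refine hout N _ (hcard.trans (π.card_toNet_nodes hfin hdeg hident).symm) _ ?_ hq
    rw [hcard]
    exact Net.agree_of_know_eq hN hnode hknow
  · exact fun hq => ⟨_, π.card_toNet_nodes hfin hdeg hident, hnode, rfl, hq⟩

end PortNumbering

/-! ### From paths in the network of identifiers to paths in the multigraph -/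

section Decode

variable {α β : Type*} {G : Graph α β} (π : PortNumbering G)

/-- The path that leaves its nodes through the ports `ρ d`, where `d` runs through `l`. -/
def decodePath (ρ : ℕ × ℕ → Port G) (v : α) (l : List (ℕ × ℕ)) : EdgePath α β where
  start := v
  steps := l.map fun d => (π.edge (ρ d), (π.opp (ρ d)).1)

variable {π} {Δ : ℕ} {N : Net Δ} {ident : α → ℕ} {ρ : ℕ × ℕ → Port G}

theorem isWalkFrom_of_isChain (hρopp : ∀ d ∈ N.darts, ρ (N.opp d) = π.opp (ρ d))
    (hρfst : ∀ d ∈ N.darts, ∀ d' ∈ N.darts, d.1 = d'.1 → (ρ d).1 = (ρ d').1)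
    {l : List (ℕ × ℕ)} (hl : l.IsChain fun a b => (N.opp a).1 = b.1) (hd : ∀ d ∈ l, d ∈ N.darts)
    {v : α} (hv : v ∈ V(G)) (hhead : ∀ d ∈ l.head?, (ρ d).1 = v) :
    IsWalkFrom G v (l.map fun d => (π.edge (ρ d), (π.opp (ρ d)).1)) := by
  induction l generalizing v with
  | nil => exact hv
  | cons a l ih =>
    have ha := hd a (by simp)
    refine ⟨hhead a rfl ▸ π.isLink (ρ a), ih (List.isChain_cons.1 hl).2
      (fun d h => hd d (by simp [h])) (π.fst_mem _) fun d h => ?_⟩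
    rw [← hρopp a ha]
    exact hρfst d (hd d (by simp [List.mem_of_mem_head? h])) _ (N.opp_mem a ha)
      ((List.isChain_cons.1 hl).1 d h).symm

theorem map_decodePath (hρ : ∀ d ∈ N.darts, π.portName ident (ρ d) = d)
    (hρopp : ∀ d ∈ N.darts, ρ (N.opp d) = π.opp (ρ d)) {p : ℕ × ℕ} (hp : p ∈ N.darts)
    {l : List (ℕ × ℕ)} (hl : ∀ d ∈ l, d ∈ N.darts) :
    (decodePath π ρ (ρ p).1 l).map ident (π.edgeName ident) = N.pathName p.1 l := by
  have h1 : ∀ d ∈ N.darts, ident (ρ d).1 = d.1 := fun d hd => congrArg Prod.fst (hρ d hd)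
  simp only [decodePath, EdgePath.map, Net.pathName, h1 p hp, List.map_map]
  congr 1
  refine List.map_congr_left fun d hd => ?_
  have hd := hl d hd
  have hd' := N.opp_mem d hd
  simp only [Function.comp, Prod.map, π.edgeName_edge, ← hρopp d hd, hρ d hd, hρ _ hd', h1 _ hd']

theorem finish_decodePath {F : ℕ × ℕ → List (ℕ × ℕ)} {i : ℕ} (h : N.IsPathSystem i F)
    (hρopp : ∀ d ∈ N.darts, ρ (N.opp d) = π.opp (ρ d)) {p : ℕ × ℕ} (hp : F p ≠ []) (v : α) :
    (decodePath π ρ v (F p)).finish = (ρ (N.far F p)).1 := by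
  obtain ⟨x, hx, h1, h2⟩ := Net.exists_far_eq_opp (N := N) hp
  have h3 : (decodePath π ρ v (F p)).vertices.getLast? = some (π.opp (ρ x)).1 := by
    rw [EdgePath.vertices, decodePath, List.map_map, List.getLast?_cons, List.getLast?_map, h1]
    rfl
  rw [h2, hρopp x (h.mem_darts p x hx)]
  exact Option.some_inj.1 ((List.getLast?_eq_some_getLast _).symm.trans h3)

end Decode

/-! ### The path decomposition of the multigraph -/

section Decode

variable {α β : Type*} {G : Graph α β} {π : PortNumbering G}
  {Δ i : ℕ} {N : Net Δ} {ident : α → ℕ} {ρ : ℕ × ℕ → Port G} {F : ℕ × ℕ → List (ℕ × ℕ)}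

open Classical in
/-- The paths of a path system, each one in one direction, as paths of the multigraph. -/
noncomputable def decodeSystem (π : PortNumbering G) (ρ : ℕ × ℕ → Port G) (N : Net Δ)
    (F : ℕ × ℕ → List (ℕ × ℕ)) : Finset (EdgePath α β) :=
  (N.darts.filter fun p => F p ≠ [] ∧ Encodable.encode p < Encodable.encode (N.far F p)).image
    fun p => decodePath π ρ (ρ p).1 (F p)

theorem mem_decodeSystem (h : N.IsPathSystem i F) {q : EdgePath α β} :
    q ∈ decodeSystem π ρ N F ↔ ∃ p, F p ≠ [] ∧
      Encodable.encode p < Encodable.encode (N.far F p) ∧ decodePath π ρ (ρ p).1 (F p) = q := by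
  simp only [decodeSystem, Finset.mem_image, Finset.mem_filter]
  exact exists_congr fun p => ⟨fun hp => ⟨hp.1.2.1, hp.1.2.2, hp.2⟩,
    fun hp => ⟨⟨h.self_mem_darts hp.1, hp.1, hp.2.1⟩, hp.2.2⟩⟩

theorem edges_decodePath (v : α) (l : List (ℕ × ℕ)) :
    (decodePath π ρ v l).edges = l.map fun d => π.edge (ρ d) := by
  simp [EdgePath.edges, decodePath, Function.comp_def]

theorem isPathDecomposition_decodeSystem (h : N.IsPathSystem i F)
    (hρ : ∀ d ∈ N.darts, π.portName ident (ρ d) = d)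
    (hρ' : ∀ p, π.portName ident p ∈ N.darts ∧ ρ (π.portName ident p) = p)
    (hρopp : ∀ d ∈ N.darts, ρ (N.opp d) = π.opp (ρ d))
    (hident : Set.InjOn ident V(G)) (hnodes : ∀ v ∈ V(G), ident v ∈ N.nodes) :
    IsPathDecomposition G (fun _ => ((Δ - 2 * i : ℕ) : ℝ≥0)) (2 ^ i) (decodeSystem π ρ N F) := by
  have hinj : ∀ d ∈ N.darts, ∀ d' ∈ N.darts, ρ d = ρ d' → d = d' := fun d hd d' hd' heq => by
    rw [← hρ d hd, heq, hρ d' hd']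
  have hfst : ∀ d ∈ N.darts, ident (ρ d).1 = d.1 := fun d hd => congrArg Prod.fst (hρ d hd)
  have hopp : ∀ p, F p ≠ [] → ∀ d, d ∈ F p → N.opp d ∈ F (N.far F p) := by
    intro p hp d hd
    rw [h.reverse p hp]
    exact List.mem_reverse.2 (List.mem_map_of_mem hd)
  have hedge : ∀ d ∈ N.darts, ∀ d' ∈ N.darts, π.edge (ρ d) = π.edge (ρ d') →
      d' = d ∨ d' = N.opp d := by
    intro d hd d' hd' heq
    refine ((π.edge_eq_iff _ _).1 heq).imp (hinj _ hd' _ hd) fun h1 => ?_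
    rw [← hρopp d hd] at h1
    exact hinj _ hd' _ (N.opp_mem d hd) h1
  have hedge' : ∀ p, F p ≠ [] → ∀ d ∈ F p, ∀ q, ∀ d' ∈ F q, π.edge (ρ d) = π.edge (ρ d') →
      q = p ∧ d' = d ∨ q = N.far F p := by
    intro p hp d hd q d' hd' heq
    refine (hedge d (h.mem_darts p d hd) d' (h.mem_darts q d' hd') heq).imp ?_ ?_
    · rintro rfl
      exact ⟨h.eq_of_mem hd' hd, rfl⟩
    · rintro rfl
      exact h.eq_of_mem hd' (hopp p hp d hd)
  refine ⟨?_, ?_, ?_, ?_⟩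
  · intro q hq
    obtain ⟨p, hp, -, rfl⟩ := (mem_decodeSystem h).1 hq
    refine ⟨?_, ?_, ?_⟩
    · refine isWalkFrom_of_isChain hρopp ?_ (h.chain p) (h.mem_darts p) (π.fst_mem _) ?_
      · intro d hd d' hd' heq
        exact hident (π.fst_mem _) (π.fst_mem _) (by rw [hfst d hd, hfst d' hd', heq])
      · intro d hd
        rw [h.head?_eq p hp] at hd
        obtain rfl : p = d := by simpa using hd
        rfl
    · rw [edges_decodePath]
      refine (h.nodup p).map_on fun d hd d' hd' heq => ?_
      -- Two distinct ports of one edge on the same path would make the path its own reversal, with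
      -- `N.far F p = p`.
      rcases hedge' p hp d hd p d' hd' heq with h1 | h1
      · exact h1.2.symm
      · exact absurd h1.symm (h.far_ne p hp)
    · simpa [decodePath] using hp
  · intro e he
    obtain ⟨x, rfl⟩ := π.edge_surj e he
    obtain ⟨hd, hx⟩ := hρ' x
    obtain ⟨d, hdx⟩ : ∃ d, d = π.portName ident x := ⟨_, rfl⟩
    rw [← hdx] at hd hx
    subst hx
    obtain ⟨p, hp, -⟩ := h.cover d hd
    have hpF := List.ne_nil_of_mem hp
    have hne : Encodable.encode p ≠ Encodable.encode (N.far F p) := fun hc =>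
      h.far_ne p hpF (Encodable.encode_injective hc).symm
    have huniq : ∀ q, q ∈ decodeSystem π ρ N F ∧ π.edge (ρ d) ∈ q.edges → ∃ p', (p' = p ∨
        p' = N.far F p) ∧ Encodable.encode p' < Encodable.encode (N.far F p') ∧
        decodePath π ρ (ρ p').1 (F p') = q := by
      rintro q ⟨hq, he⟩
      obtain ⟨p', hp', hlt, rfl⟩ := (mem_decodeSystem h).1 hq
      rw [edges_decodePath] at he
      obtain ⟨d', hd', heq⟩ := List.mem_map.1 he
      exact ⟨p', (hedge' p hpF d hp p' d' hd' heq.symm).imp_left And.left, hlt, rfl⟩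
    -- Exactly one of the two directions, from `p` or from `N.far F p`, is kept.
    rcases hne.lt_or_gt with hlt | hlt
    · refine ⟨_, ⟨(mem_decodeSystem h).2 ⟨p, hpF, hlt, rfl⟩, ?_⟩, ?_⟩
      · rw [edges_decodePath]
        exact List.mem_map_of_mem (f := fun d => π.edge (ρ d)) hp
      · intro q hq
        obtain ⟨p', rfl | rfl, hlt', rfl⟩ := huniq q hq
        · rfl
        · rw [h.far_far hpF] at hlt'
          exact absurd hlt' hlt.not_gt
    · have hff := h.far_far hpF
      refine ⟨_, ⟨(mem_decodeSystem h).2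
        ⟨N.far F p, h.map_far_ne_nil hpF, by rwa [hff], rfl⟩, ?_⟩, ?_⟩
      · rw [edges_decodePath, show π.edge (ρ d) = π.edge (ρ (N.opp d)) from
          (π.edge_eq_iff _ _).2 (Or.inr (hρopp d hd))]
        exact List.mem_map_of_mem (f := fun d => π.edge (ρ d)) (hopp p hpF d hp)
      · intro q hq
        obtain ⟨p', rfl | rfl, hlt', rfl⟩ := huniq q hq
        · exact absurd hlt' hlt.not_gt
        · rfl
  · intro v hv
    have hcount := h.count (ident v) (hnodes v hv)
    have hfinite := h.finite_setOf_ne_nil (ident v)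
    -- `A` holds the ports at `v` where a kept direction starts, `B` those where one ends. A closed
    -- path at `v` uses one port of each, so counting it twice fits the number of path ends at `v`.
    obtain ⟨A, hA⟩ : ∃ A : Set ℕ, A = {j | F (ident v, j) ≠ [] ∧
      Encodable.encode (ident v, j) < Encodable.encode (N.far F (ident v, j))} := ⟨_, rfl⟩
    obtain ⟨B, hB⟩ : ∃ B : Set ℕ, B = {j | F (ident v, j) ≠ [] ∧
      Encodable.encode (N.far F (ident v, j)) < Encodable.encode (ident v, j)} := ⟨_, rfl⟩
    have hAsub : A ⊆ {j | F (ident v, j) ≠ []} := hA ▸ fun j hj => hj.1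
    have hBsub : B ⊆ {j | F (ident v, j) ≠ []} := hB ▸ fun j hj => hj.1
    have hdisj : Disjoint A B := by
      rw [hA, hB]
      exact Set.disjoint_left.2 fun j hj hj' => hj.2.not_gt hj'.2
    have hunion : A.ncard + B.ncard ≤ {j | F (ident v, j) ≠ []}.ncard := by
      rw [← Set.ncard_union_eq hdisj (hfinite.subset hAsub) (hfinite.subset hBsub)]
      exact Set.ncard_le_ncard (Set.union_subset hAsub hBsub) hfinite
    have h1 : {p | p ∈ decodeSystem π ρ N F ∧ p.start = v}.ncard ≤ A.ncard := by
      refine (Set.ncard_le_ncard ?_ ((hfinite.subset hAsub).image fun j =>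
        decodePath π ρ (ρ (ident v, j)).1 (F (ident v, j)))).trans
        (Set.ncard_image_le (hfinite.subset hAsub))
      rintro q ⟨hq, hqv⟩
      obtain ⟨p, hp, hlt, rfl⟩ := (mem_decodeSystem h).1 hq
      have hpv : (ident v, p.2) = p :=
        Prod.ext (by rw [← hfst p (h.self_mem_darts hp)]; exact congrArg ident hqv.symm) rfl
      exact ⟨p.2, by rw [hA, Set.mem_ofPred_eq, hpv]; exact ⟨hp, hlt⟩, by simp only [hpv]⟩
    have h2 : {p | p ∈ decodeSystem π ρ N F ∧ p.finish = v}.ncard ≤ B.ncard := by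
      refine (Set.ncard_le_ncard ?_ ((hfinite.subset hBsub).image fun j =>
        decodePath π ρ (ρ (N.far F (ident v, j))).1 (F (N.far F (ident v, j))))).trans
        (Set.ncard_image_le (hfinite.subset hBsub))
      rintro q ⟨hq, hqv⟩
      obtain ⟨p, hp, hlt, rfl⟩ := (mem_decodeSystem h).1 hq
      rw [finish_decodePath h hρopp hp] at hqv
      have hp' := h.map_far_ne_nil hp
      have hff := h.far_far hp
      have hpv : (ident v, (N.far F p).2) = N.far F p :=
        Prod.ext (by rw [← hfst _ (h.self_mem_darts hp'), hqv]) rfl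
      refine ⟨(N.far F p).2, ?_, by simp only [hpv, hff]⟩
      rw [hB, Set.mem_ofPred_eq, hpv, hff]
      exact ⟨hp', hlt⟩
    have h3 : {p | p ∈ decodeSystem π ρ N F ∧ p.start = v}.ncard +
        {p | p ∈ decodeSystem π ρ N F ∧ p.finish = v}.ncard ≤ Δ - 2 * i := by omega
    exact Nat.cast_le.2 h3
  · intro q hq
    obtain ⟨p, hp, -, rfl⟩ := (mem_decodeSystem h).1 hq
    simpa [decodePath, EdgePath.length] using h.length_le p

theorem pathsAt_eq (h : N.IsPathSystem i F)
    (hρ : ∀ d ∈ N.darts, π.portName ident (ρ d) = d)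
    (hρopp : ∀ d ∈ N.darts, ρ (N.opp d) = π.opp (ρ d))
    (hident : Set.InjOn ident V(G)) {v : α} (hv : v ∈ V(G)) :
    N.pathsAt F (ident v) = {q | ∃ p ∈ decodeSystem π ρ N F, v ∈ p.vertices ∧
      q = p.map ident (π.edgeName ident)} := by
  have hfst : ∀ d ∈ N.darts, (ident v = d.1 ↔ v = (ρ d).1) := fun d hd => by
    rw [← (congrArg Prod.fst (hρ d hd) : ident (ρ d).1 = d.1)]
    exact ⟨fun heq => hident hv (π.fst_mem _) heq, congrArg ident⟩
  have hvert : ∀ p, F p ≠ [] → (v ∈ (decodePath π ρ (ρ p).1 (F p)).vertices ↔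
      ident v = p.1 ∨ ∃ d ∈ F p, ident v = (N.opp d).1) := by
    intro p hp
    rw [hfst p (h.self_mem_darts hp)]
    simp only [EdgePath.vertices, decodePath, List.mem_cons, List.map_map, List.mem_map,
      Function.comp]
    refine or_congr_right (exists_congr fun d => and_congr_right fun hd => ?_)
    have hd := h.mem_darts p d hd
    rw [hfst _ (N.opp_mem d hd), hρopp d hd, eq_comm]
  ext q
  constructor
  · rintro ⟨p, hp, hlt, hmem, rfl⟩
    exact ⟨_, (mem_decodeSystem h).2 ⟨p, hp, hlt, rfl⟩, (hvert p hp).2 hmem,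
      (map_decodePath hρ hρopp (h.self_mem_darts hp) (h.mem_darts p)).symm⟩
  · rintro ⟨x, hx, hmem, rfl⟩
    obtain ⟨p, hp, hlt, rfl⟩ := (mem_decodeSystem h).1 hx
    exact ⟨p, hp, hlt, (hvert p hp).1 hmem,
      map_decodePath hρ hρopp (h.self_mem_darts hp) (h.mem_darts p)⟩

end Decode

/-! ### The round bound and the main theorem -/

/-- The number of rounds is logarithmic in the number of nodes. -/
theorem rounds_le {n : ℕ} (hn : 2 ≤ n) (k : ℕ) :
    ((2 ^ k + (2 ^ k + 2 ^ k * (2 * Net.searchDepth n + 2)) + 1 : ℕ) : ℝ) ≤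
      58 * (2 ^ k * Real.log n) := by
  have hlog2 : 0 < Real.log 2 := Real.log_pos one_lt_two
  have h1 : 1 ≤ Nat.log 2 n := Nat.log_pos one_lt_two hn
  have h2 : 2 ^ k + (2 ^ k + 2 ^ k * (2 * Net.searchDepth n + 2)) + 1 ≤
      2 ^ k * (29 * Nat.log 2 n) := by
    have h3 : 1 ≤ 2 ^ k := Nat.one_le_two_pow
    calc 2 ^ k + (2 ^ k + 2 ^ k * (2 * Net.searchDepth n + 2)) + 1
        ≤ 2 ^ k + (2 ^ k + 2 ^ k * (2 * Net.searchDepth n + 2)) + 2 ^ k := by gcongr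
      _ = 2 ^ k * (2 * Net.searchDepth n + 5) := by ring
      _ ≤ _ := by
        -- With `L = Nat.log 2 n`, the left factor is `8 * L + 21`, at most `29 * L` because `1 ≤
        -- L`. The bound `1 / 2 ≤ Real.log 2` later turns 29 into 58.
        refine Nat.mul_le_mul_left _ ?_
        rw [Net.searchDepth]
        omega
  have h3 : (Nat.log 2 n : ℝ) * Real.log 2 ≤ Real.log n := by
    rw [← Real.log_pow]
    refine Real.log_le_log (by positivity) ?_
    exact_mod_cast Nat.pow_log_le_self 2 (by omega)
  have h4 : (1 : ℝ) / 2 ≤ Real.log 2 := by linarith [Real.log_two_gt_d9]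
  have h5 : (Nat.log 2 n : ℝ) ≤ 2 * Real.log n := by
    have : (Nat.log 2 n : ℝ) * (1 / 2) ≤ Nat.log 2 n * Real.log 2 := by gcongr
    linarith
  calc ((2 ^ k + (2 ^ k + 2 ^ k * (2 * Net.searchDepth n + 2)) + 1 : ℕ) : ℝ)
      ≤ ((2 ^ k * (29 * Nat.log 2 n) : ℕ) : ℝ) := Nat.cast_le.2 h2
    _ = 2 ^ k * (29 * Nat.log 2 n) := by push_cast; ring
    _ ≤ 2 ^ k * (29 * (2 * Real.log n)) := by gcongr
    _ = _ := by ring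

end LocalModel

theorem mainTheorem9 :
    ∃ C : ℝ, ∀ Δ k : ℕ, 0 < k → (k : ℝ) ≤ (Δ : ℝ) / 2 - 2 →
      ∃ A : LocalModel.LocalAlgorithm LocalModel.PathSet,
        (∀ n : ℕ, 2 ≤ n → (A.rounds n : ℝ) ≤ C * (2 ^ k * Real.log n)) ∧
        ∀ (α β : Type*) (G : Graph α β), V(G).Finite → E(G).Finite → 2 ≤ V(G).ncard →
          (∀ v ∈ V(G), LocalModel.degree G v = Δ) →
          ∀ (π : LocalModel.PortNumbering G) (ident : α → ℕ), Set.InjOn ident V(G) →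
            LocalModel.ComputesPathDecomposition A π ident
              (fun _ => ((Δ - 2 * k : ℕ) : ℝ≥0)) (2 ^ k) := by
  refine ⟨58, fun Δ k _ hkΔ => ?_⟩
  have hk : 2 * k + 4 ≤ Δ := by
    have : (2 : ℝ) * k + 4 ≤ Δ := by linarith
    exact_mod_cast this
  obtain ⟨F, hF, hloc⟩ := LocalModel.Net.exists_isPathSystem hk
  refine ⟨LocalModel.collectAlgorithm
    (fun n => 2 ^ k + (2 ^ k + 2 ^ k * (2 * LocalModel.Net.searchDepth n + 2)) + 1)
    (fun N v => N.pathsAt (F N) v), fun n hn => LocalModel.rounds_le hn k, ?_⟩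
  intro α β G hfin _ hcard hdeg π ident hident
  obtain ⟨N, hN⟩ : ∃ N, N = π.toNet ident hfin hdeg hident := ⟨_, rfl⟩
  have hnodes : ∀ v ∈ V(G), ident v ∈ N.nodes := fun v hv => by
    rw [hN]
    exact (π.mem_toNet_nodes hfin hdeg hident).2 ⟨v, hv, rfl⟩
  have hsurj : ∀ d ∈ N.darts, ∃ p, π.portName ident p = d := fun d hd =>
    π.exists_portName_eq hfin hdeg (by rw [hN] at hd; exact hd)
  -- This supplies the default value that `choose!` needs for `ρ` off the darts; a port exists
  -- because `Δ` is positive and the multigraph has a node.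
  have hports : Nonempty (LocalModel.Port G) := by
    obtain ⟨v, hv⟩ := Set.nonempty_of_ncard_ne_zero (by omega : V(G).ncard ≠ 0)
    exact ⟨⟨v, ⟨0, by rw [hdeg v hv]; omega⟩⟩⟩
  choose! ρ hρ using hsurj
  have hρ' : ∀ p, π.portName ident p ∈ N.darts ∧ ρ (π.portName ident p) = p := by
    intro p
    have hp : π.portName ident p ∈ N.darts := by
      rw [hN]
      exact π.portName_mem hfin hdeg p
    exact ⟨hp, π.portName_injective hident (hρ _ hp)⟩
  have hρopp : ∀ d ∈ N.darts, ρ (N.opp d) = π.opp (ρ d) := by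
    intro d hd
    have h1 : N.opp (π.portName ident (ρ d)) = π.portName ident (π.opp (ρ d)) := by
      rw [hN]
      exact π.toNet_opp hfin hdeg hident (ρ d)
    rw [hρ d hd] at h1
    rw [h1, (hρ' _).2]
  refine ⟨LocalModel.decodeSystem π ρ N (F N),
    LocalModel.isPathDecomposition_decodeSystem (hF N) hρ hρ' hρopp hident hnodes, ?_⟩
  intro v hv
  rw [← LocalModel.pathsAt_eq (hF N) hρ hρopp hident hv, hN]
  refine π.outputAt_collectAlgorithm hfin hdeg hident
    (out := fun N v => N.pathsAt (F N) v) ?_ hv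
  intro N₁ N₂ hcard' u hu
  exact LocalModel.Net.pathsAt_subset (hF N₁) (hloc N₁ N₂ hcard') hu
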